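/- Let $(\Sigma,g)$ be a compact oriented Riemannian two-manifold (without boundary), let $(\mathcal L,h)$ be a smooth hermitian line bundle over $\Sigma$ of degree $n\ge 1$, and let $\kappa\in\mathbb R$. For a smooth section $\phi$ of $\mathcal L$, a smooth metric connexion $A$ on $\mathcal L$ with covariant derivative $\mathrm d_A$ and magnetic field $B$ (the real 2-form such that the curvature of $A$ is $-iB$; locally $\mathrm d_A=\mathrm d-iA$ and $B=\mathrm dA$, so that $\int_\Sigma B=2\pi n$), and a smooth function $N:\Sigma\to\mathbb R$, consider the Maxwell-Chern-Simons-Higgs (MCSH) Bogomol'nyi equations $$\overline\partial_A\phi=0,\qquad *B=\tfrac12\left(1+2\kappa N-|\phi|^2\right),\qquad \Delta N+\kappa *B+|\phi|^2N=0,$$ where $\overline\partial_A\phi$ is the $(0,1)$ part of $\mathrm d_A\phi$ with respect to the almost complex structure defined by $g$ and the orientation, $*$ is the Hodge star and $\Delta=-*\mathrm d*\mathrm d$ is the nonnegative Laplacian. If these equations have a smooth solution $(\phi,A,N)$, then $$\kappa^2\le\frac{\mathrm{Vol}(\Sigma)}{4\pi n}-1 .$$ Equivalently, if $\mathrm{Vol}(\Sigma)<4\pi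 n(1+\kappa^2)$, then the equations have no smooth solution. -/

import Mathlib

open scoped Manifold ContDiff Bundle

open Bundle

/- The real inner product on the fibres of a hermitian bundle is the real part of the hermitian
product. -/
attribute [local instance] InnerProductSpace.complexToReal

namespace MCSH

open MeasureTheory Module

/-- The model space of a real surface. -/
abbrev Plane : Type := EuclideanSpace ℝ (Fin 2)

/-- A complex vector bundle is in particular a real vector bundle (same trivializations). -/
instance realVectorBundle {S : Type*} [TopologicalSpace S]
    {L : S → Type*} [TopologicalSpace (Bundle.TotalSpace ℂ L)]
    [∀ x, NormedAddCommGroup (L x)] [∀ x, InnerProductSpace ℂ (L x)]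
    [FiberBundle ℂ L] [VectorBundle ℂ ℂ L] : VectorBundle ℝ ℂ L where
  trivialization_linear' e _ :=
    ⟨fun b hb => ⟨(Bundle.Trivialization.linear ℂ e hb).map_add,
      fun c v => by
        have h := (Bundle.Trivialization.linear ℂ e hb).map_smul (c : ℂ) v
        have h1 : (c : ℂ) • v = c • v := Complex.coe_smul c v
        rw [h1] at h
        rw [h]
        exact Complex.coe_smul c _⟩⟩
  continuousOn_coordChange' e e' _ _ := by
    have h := continuousOn_coordChange ℂ e e'
    refine ((ContinuousLinearMap.restrictScalarsL ℂ ℂ ℂ ℝ ℝ).continuous.comp_continuousOn h).congr ?_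
    intro b hb
    ext
    simp [Bundle.Trivialization.coordChangeL_apply, hb]

section Surface

variable {S : Type*} [TopologicalSpace S] [ChartedSpace Plane S]

instance finrankTangent (x : S) : Fact (finrank ℝ (TangentSpace (𝓡 2) x) = 2) :=
  ⟨finrank_euclideanSpace_fin (𝕜 := ℝ) (n := 2)⟩

/-- The `i`-th coordinate vector field `∂ᵢ` of the chart centred at `x₀`, at the point of the
surface that has coordinates `y`. -/
noncomputable def coordVec (x₀ : S) (y : Plane) (i : Fin 2) :
    TangentSpace (𝓡 2) ((extChartAt (𝓡 2) x₀).symm y) :=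
  mfderiv 𝓘(ℝ, Plane) (𝓡 2) (extChartAt (𝓡 2) x₀).symm y (EuclideanSpace.single i (1 : ℝ) : Plane)

/-- A (not necessarily continuous) 1-form on the surface. -/
abbrev OneForm (S : Type*) [TopologicalSpace S] [ChartedSpace Plane S] :=
  ∀ x : S, TangentSpace (𝓡 2) x →L[ℝ] ℝ

/-- A (not necessarily continuous) 2-form on the surface. -/
abbrev TwoForm (S : Type*) [TopologicalSpace S] [ChartedSpace Plane S] :=
  ∀ x : S, TangentSpace (𝓡 2) x [⋀^Fin 2]→L[ℝ] ℝ

/-- The coordinate expression of a 1-form in the chart centred at `x₀`. -/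
noncomputable def OneForm.inChart (α : OneForm S) (x₀ : S) : Plane → Plane [⋀^Fin 1]→L[ℝ] ℝ :=
  fun y => ContinuousAlternatingMap.ofSubsingleton ℝ Plane ℝ (0 : Fin 1)
    ((α ((extChartAt (𝓡 2) x₀).symm y)).comp
      (mfderiv 𝓘(ℝ, Plane) (𝓡 2) (extChartAt (𝓡 2) x₀).symm y))

/-- The exterior derivative `dα` of a 1-form. -/
noncomputable def OneForm.d (α : OneForm S) : TwoForm S := fun x =>
  (extDeriv (α.inChart x) (extChartAt (𝓡 2) x x)).compContinuousLinearMap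
    (mfderiv (𝓡 2) 𝓘(ℝ, Plane) (extChartAt (𝓡 2) x) x)

/-- The differential `df` of a function. -/
noncomputable def differential (f : S → ℝ) : OneForm S := fun x =>
  mfderiv (𝓡 2) 𝓘(ℝ, ℝ) f x

section Metric

variable [RiemannianBundle (fun x : S => TangentSpace (𝓡 2) x)]

/-- The Riemannian density `√det (g(∂ᵢ, ∂ⱼ))` in the chart centred at `x₀`. -/
noncomputable def volDensity (x₀ : S) (y : Plane) : ℝ :=
  Real.sqrt (Matrix.of fun i j : Fin 2 => inner ℝ (coordVec x₀ y i) (coordVec x₀ y j)).det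

/-- The Riemannian volume on the domain of the chart centred at `x₀`: the measure
`√det g dy¹dy²`, carried over to the surface. -/
noncomputable def chartVol [MeasurableSpace S] (x₀ : S) : Measure S :=
  (((volume : Measure Plane).restrict (extChartAt (𝓡 2) x₀).target).withDensity
    (fun y => ENNReal.ofReal (volDensity x₀ y))).map (extChartAt (𝓡 2) x₀).symm

variable (S) in
/-- The Riemannian volume measure: the least measure that dominates the volume of each coordinate
chart. As the latter agree on overlaps, this is the measure which equals `√det g dy¹dy²` in each
chart. -/
noncomputable def riemannianVolume [MeasurableSpace S] : Measure S := ⨆ x₀ : S, chartVol x₀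

/-- A family of orientations of the tangent planes is an orientation of the surface if it is
continuous: near each point, the sign of the coordinate frame of a chart does not change. -/
def IsOrientation (o : ∀ x : S, Orientation ℝ (TangentSpace (𝓡 2) x) (Fin 2)) : Prop :=
  ∀ x₀ : S, ∀ᶠ y in nhds (extChartAt (𝓡 2) x₀ x₀),
    (0 < (o _).areaForm (coordVec x₀ y 0) (coordVec x₀ y 1) ↔
      0 < (o _).areaForm (coordVec x₀ (extChartAt (𝓡 2) x₀ x₀) 0)
        (coordVec x₀ (extChartAt (𝓡 2) x₀ x₀) 1))

variable (o : ∀ x : S, Orientation ℝ (TangentSpace (𝓡 2) x) (Fin 2))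

/-- The almost complex structure: rotation of the tangent plane by a positive right angle. -/
noncomputable def rot (x : S) : TangentSpace (𝓡 2) x →L[ℝ] TangentSpace (𝓡 2) x :=
  ((o x).rightAngleRotation.toContinuousLinearEquiv : _ ≃L[ℝ] _).toContinuousLinearMap

/-- The Hodge star on 1-forms, `(*α)(v) = -α(Jv)`; in oriented orthonormal coordinates,
`*dx = dy` and `*dy = -dx`. -/
noncomputable def starOne (α : OneForm S) : OneForm S := fun x => -((α x).comp (rot o x))

/-- The Hodge star on 2-forms: the function `*β = β(v, Jv) / |v|²`, for any tangent vector
`v ≠ 0`; so `β = (*β) · (area form)`. -/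
noncomputable def starTwo (β : TwoForm S) : S → ℝ := fun x =>
  let v : TangentSpace (𝓡 2) x := (EuclideanSpace.single 0 (1 : ℝ) : Plane)
  β x ![v, rot o x v] / ‖v‖ ^ 2

/-- The Hodge Laplacian on functions, `Δf = δdf = -*d*df` (a nonnegative operator). -/
noncomputable def laplacian (f : S → ℝ) : S → ℝ := fun x =>
  -starTwo o (starOne o (differential f)).d x

end Metric

section Bundle

variable (L : S → Type*) [TopologicalSpace (Bundle.TotalSpace ℂ L)]
  [∀ x, NormedAddCommGroup (L x)] [∀ x, InnerProductSpace ℂ (L x)]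
  [FiberBundle ℂ L]

/-- The local unit-length frame of the hermitian line bundle given by the trivialization
around `x₀`. -/
noncomputable def unitFrame (x₀ y : S) : L y :=
  (‖(trivializationAt ℂ L x₀).symm y 1‖⁻¹ : ℝ) • (trivializationAt ℂ L x₀).symm y 1

variable {L}

/-- The connexion 1-form `A` in the unit-length frame `e` around `x₀`, defined by
`d_A e = -i A e`, so `A(v) = ⟨e, i d_A e(v)⟩`. -/
noncomputable def connForm (D : CovariantDerivative (𝓡 2) ℂ L) (x₀ : S) : OneForm S := fun y =>
  (innerSL ℝ (unitFrame L x₀ y)).comp (Complex.I • D (unitFrame L x₀) y)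

/-- The magnetic field `B = dA` (so the curvature is `-iB`). It does not depend on the local
frame that is used. -/
noncomputable def magneticField (D : CovariantDerivative (𝓡 2) ℂ L) : TwoForm S := fun x =>
  (connForm D x).d x

variable [IsManifold (𝓡 2) ∞ S] [VectorBundle ℂ ℂ L] [ContMDiffVectorBundle ∞ ℂ L (𝓡 2)]
  [IsContMDiffRiemannianBundle (𝓡 2) ∞ ℂ L]

/-- A smooth metric connexion on the hermitian line bundle. -/
structure IsMetricConnexion (D : CovariantDerivative (𝓡 2) ℂ L) : Prop where
  smooth : CovariantDerivative.ContMDiffCovariantDerivative D ∞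
  complex_linear : ∀ (σ : ∀ x, L x) (x : S),
    MDifferentiableAt (𝓡 2) ((𝓡 2).prod 𝓘(ℝ, ℂ)) (fun y => Bundle.TotalSpace.mk' ℂ y (σ y)) x →
    D (fun y => Complex.I • σ y) x = Complex.I • D σ x
  metric : D.IsMetricCompatible

variable [RiemannianBundle (fun x : S => TangentSpace (𝓡 2) x)]
  (o : ∀ x : S, Orientation ℝ (TangentSpace (𝓡 2) x) (Fin 2))

variable (L) in
/-- `L` has degree `n`: the integral over the surface of the first Chern form `B / 2π` of a
smooth metric connexion on `L` is `n`. (By Stokes' theorem it is the same for all of them.)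
The integral of a 2-form `β` is that of `*β` against the Riemannian volume. -/
def HasDegree [MeasurableSpace S] (n : ℤ) : Prop :=
  ∃ D : CovariantDerivative (𝓡 2) ℂ L, IsMetricConnexion D ∧
    ∫ x, starTwo o (magneticField D) x ∂(riemannianVolume S) = 2 * Real.pi * n

/-- The antiholomorphic part `∂̄_A φ` of `d_A φ`, as a real-linear map on the tangent plane. -/
noncomputable def dbar (D : CovariantDerivative (𝓡 2) ℂ L) (φ : ∀ x, L x) (x : S) :
    TangentSpace (𝓡 2) x →L[ℝ] L x :=
  (1 / 2 : ℝ) • (D φ x + Complex.I • (D φ x).comp (rot o x))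

/-- `(φ, A, N)` is a smooth solution of the Bogomol'nyi equations with Chern-Simons
coupling `κ`. -/
structure IsBogomolnyiSolution (κ : ℝ) (φ : ∀ x, L x) (D : CovariantDerivative (𝓡 2) ℂ L)
    (N : S → ℝ) : Prop where
  smooth_section : ContMDiff (𝓡 2) ((𝓡 2).prod 𝓘(ℝ, ℂ)) ∞ fun x => Bundle.TotalSpace.mk' ℂ x (φ x)
  connexion : IsMetricConnexion D
  smooth_scalar : ContMDiff (𝓡 2) 𝓘(ℝ, ℝ) ∞ N
  bog1 : ∀ x, dbar o D φ x = 0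
  bog2 : ∀ x, starTwo o (magneticField D) x = 1 / 2 * (1 + 2 * κ * N x - ‖φ x‖ ^ 2)
  bog3 : ∀ x, laplacian o N x + κ * starTwo o (magneticField D) x + ‖φ x‖ ^ 2 * N x = 0

end Bundle

end Surface

end MCSH

/-!
Write `P = |φ|²`. The bound follows from the maximum principle and from the integrals of `*B` and
`ΔN` over the surface.

A linear combination of the second and third equations is the pointwise identity
`1 - 2(1 + κ²) *B - 2κ ΔN = P - 2κN(1 - P)`. The integral of the left-hand side is
`Vol - 4πn(1 + κ²)`: the total flux of `B` is `2πn`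
(`MCSH.IsMetricConnexion.integral_magneticField`) and `ΔN` is exact. So it suffices that `P ≤ 1` and
`κN ≤ 0`, which is `MCSH.IsBogomolnyiSolution.normSq_le_one_and_nonpos`:

* At a maximum of `P`, if it is positive, `φ` has a local logarithm in a unitary frame, and the
  holomorphy equation reads `A = dθ - *du` with `φ = exp(u + iθ)e` up to a constant. Hence
  `*B = Δu`, which is nonnegative at a maximum of `u`
  (`MCSH.IsMetricConnexion.starTwo_magneticField_nonneg`). The second equation then gives
  `max P ≤ 1 + 2 max κN`.
* At a maximum of `κN`, `κ ΔN ≥ 0` (`MCSH.laplacian_nonneg_of_isLocalMax`), so the other two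
  equations give `κN (κ² + P) ≤ κ² (P - 1) / 2` there. Together with the first point
  this forces `max P ≤ 1`, and then `max κN ≤ 0`.

Both integrals come from Stokes' theorem for a global 1-form of class `C¹`
(`MCSH.OneForm.IsC1.integral_starTwo_d_eq_zero`), proved with a partition of unity, together with
the expression of the Riemannian volume in a chart (`MCSH.riemannianVolume_restrict_source`).
Stokes' theorem applies to `*dN`, and to the difference of two metric connexions, a global 1-form
(`MCSH.IsMetricConnexion.connForm_sub_connForm`); so the flux does not depend on the connexion.
-/

namespace MCSH

open MeasureTheory Module Filter Topology Set

/-! ### Oriented planes -/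

section OrientedPlane

variable {E : Type*} [NormedAddCommGroup E] [InnerProductSpace ℝ E] [Fact (finrank ℝ E = 2)]
  (o : Orientation ℝ E (Fin 2))

lemma alternating_eq_smul_areaForm (β : E [⋀^Fin 2]→L[ℝ] ℝ) :
    ∃ c : ℝ, ∀ u v, β ![u, v] = c * o.areaForm u v := by
  have hn : 0 < 2 := by norm_num
  let e := o.finOrthonormalBasis hn Fact.out
  have he : o.volumeForm = e.toBasis.det :=
    o.volumeForm_robust e (o.finOrthonormalBasis_orientation hn Fact.out)
  refine ⟨β e, fun u v => ?_⟩
  have h := congrArg (fun f => f ![u, v])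
    (AlternatingMap.eq_smul_basis_det e.toBasis β.toAlternatingMap)
  rw [o.areaForm_to_volumeForm, he]
  simpa using h

lemma areaForm_self_rot (v : E) : o.areaForm v (o.rightAngleRotation v) = ‖v‖ ^ 2 := by
  simp

variable {o} in
/-- Cramer's rule in an oriented plane. -/
lemma areaForm_smul_eq {u v : E} (w : E) :
    o.areaForm u v • w = o.areaForm w v • u + o.areaForm u w • v := by
  rcases eq_or_ne u 0 with rfl | hu
  · simp
  have hb (z : E) : ‖u‖ ^ 2 • z = inner ℝ u z • u + o.areaForm u z • o.rightAngleRotation u := by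
    refine ext_inner_right ℝ fun y => ?_
    have := o.inner_mul_inner_add_areaForm_mul_areaForm u z y
    simp only [inner_add_left, inner_smul_left, Orientation.inner_rightAngleRotation_left]
    simpa using this.symm
  have hn : ‖u‖ ^ 2 ≠ 0 := by positivity
  refine smul_right_injective E hn ?_
  have h1 := hb w
  have h2 := hb v
  have h3 := o.inner_mul_areaForm_sub u w v
  simp only [smul_add, smul_smul]
  rw [mul_comm, mul_smul, h1, mul_comm (‖u‖ ^ 2) (o.areaForm u w), mul_smul _ (‖u‖ ^ 2) v, h2,
    ← h3]
  module

end OrientedPlane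

/-! ### Forms in coordinate charts -/

section Charts

variable {S : Type*} [TopologicalSpace S] [ChartedSpace Plane S]

/-- The coefficient `α(∂ᵢ)` of a 1-form in the chart centred at `x₀`. -/
noncomputable def OneForm.coeff (α : OneForm S) (x₀ : S) (i : Fin 2) (y : Plane) : ℝ :=
  α ((extChartAt (𝓡 2) x₀).symm y) (coordVec x₀ y i)

lemma OneForm.inChart_apply_single (α : OneForm S) (x₀ : S) (y : Plane) (v : Fin 1 → Plane)
    (i : Fin 2) (hv : v 0 = EuclideanSpace.single i 1) :
    α.inChart x₀ y v = α.coeff x₀ i y := by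
  simp only [OneForm.inChart, OneForm.coeff, coordVec,
    ContinuousAlternatingMap.ofSubsingleton_apply_apply, hv]
  rfl

lemma OneForm.inChart_eq_sum (α : OneForm S) (x₀ : S) :
    α.inChart x₀ = fun y => ∑ i : Fin 2, α.coeff x₀ i y •
      ContinuousAlternatingMap.ofSubsingleton ℝ Plane ℝ (0 : Fin 1)
        (EuclideanSpace.proj i : Plane →L[ℝ] ℝ) := by
  funext y
  ext v
  have hv : v 0 = ∑ i : Fin 2, v 0 i • EuclideanSpace.single i (1 : ℝ) := by
    ext j; fin_cases j <;> simp
  simp only [OneForm.inChart, OneForm.coeff, coordVec,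
    ContinuousAlternatingMap.ofSubsingleton_apply_apply, ContinuousAlternatingMap.sum_apply,
    ContinuousAlternatingMap.smul_apply]
  rw [hv, map_sum]
  simp only [map_smul, smul_eq_mul, Fin.sum_univ_two]
  rw [mul_comm (v 0 0), mul_comm (v 0 1)]
  simp
  rfl

lemma OneForm.differentiableAt_inChart {α : OneForm S} {x₀ : S} {y : Plane}
    (h : ∀ i, DifferentiableAt ℝ (α.coeff x₀ i) y) : DifferentiableAt ℝ (α.inChart x₀) y := by
  rw [OneForm.inChart_eq_sum]
  exact DifferentiableAt.fun_sum fun i _ => (h i).smul_const _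

lemma OneForm.extDeriv_inChart {α : OneForm S} {x₀ : S} {y : Plane}
    (h : ∀ i, DifferentiableAt ℝ (α.coeff x₀ i) y) :
    extDeriv (α.inChart x₀) y ![EuclideanSpace.single 0 1, EuclideanSpace.single 1 1] =
      fderiv ℝ (α.coeff x₀ 1) y (EuclideanSpace.single 0 1) -
        fderiv ℝ (α.coeff x₀ 0) y (EuclideanSpace.single 1 1) := by
  rw [extDeriv_apply (OneForm.differentiableAt_inChart h), Fin.sum_univ_two]
  have h0 : (fun z => α.inChart x₀ z (Fin.removeNth 0 ![(EuclideanSpace.single 0 1 : Plane),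
      EuclideanSpace.single 1 1])) = α.coeff x₀ 1 :=
    funext fun z => α.inChart_apply_single x₀ z _ 1 rfl
  have h1 : (fun z => α.inChart x₀ z (Fin.removeNth 1 ![(EuclideanSpace.single 0 1 : Plane),
      EuclideanSpace.single 1 1])) = α.coeff x₀ 0 :=
    funext fun z => α.inChart_apply_single x₀ z _ 0 rfl
  rw [h0, h1]
  simp [sub_eq_add_neg]

lemma sigma_mfderiv_congr {f g : Plane → S} {y : Plane} (h : f =ᶠ[𝓝 y] g) :
    (⟨f y, mfderiv 𝓘(ℝ, Plane) (𝓡 2) f y⟩ : Σ z : S, Plane →L[ℝ] TangentSpace (𝓡 2) z) =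
      ⟨g y, mfderiv 𝓘(ℝ, Plane) (𝓡 2) g y⟩ :=
  Sigma.ext h.eq_of_nhds (heq_of_eq h.mfderiv_eq)

variable [IsManifold (𝓡 2) ∞ S]

lemma contMDiffAt_chart_symm (x₀ : S) {y : Plane} (hy : y ∈ (extChartAt (𝓡 2) x₀).target) :
    ContMDiffAt 𝓘(ℝ, Plane) (𝓡 2) ∞ (extChartAt (𝓡 2) x₀).symm y :=
  (contMDiffOn_extChartAt_symm (n := ∞) x₀).contMDiffAt
    ((isOpen_extChartAt_target x₀).mem_nhds hy)

lemma mdifferentiableAt_chart_symm (x₀ : S) {y : Plane}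
    (hy : y ∈ (extChartAt (𝓡 2) x₀).target) :
    MDifferentiableAt 𝓘(ℝ, Plane) (𝓡 2) (extChartAt (𝓡 2) x₀).symm y :=
  (contMDiffAt_chart_symm x₀ hy).mdifferentiableAt (by simp)

lemma contMDiffAt_chart {x₀ x : S} (hx : x ∈ (extChartAt (𝓡 2) x₀).source) :
    ContMDiffAt (𝓡 2) 𝓘(ℝ, Plane) ∞ (extChartAt (𝓡 2) x₀) x :=
  contMDiffAt_extChartAt' (by simpa using hx)

lemma mdifferentiableAt_chart {x₀ x : S} (hx : x ∈ (extChartAt (𝓡 2) x₀).source) :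
    MDifferentiableAt (𝓡 2) 𝓘(ℝ, Plane) (extChartAt (𝓡 2) x₀) x :=
  (contMDiffAt_chart hx).mdifferentiableAt (by simp)

lemma mfderiv_chart_coordVec (x₀ : S) {y : Plane} (hy : y ∈ (extChartAt (𝓡 2) x₀).target)
    (i : Fin 2) :
    (mfderiv (𝓡 2) 𝓘(ℝ, Plane) (extChartAt (𝓡 2) x₀) ((extChartAt (𝓡 2) x₀).symm y)
      (coordVec x₀ y i) : Plane) = EuclideanSpace.single i 1 := by
  have := isInvertible_mfderivWithin_extChartAt_symm (I := 𝓡 2) (x := x₀) hy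
  have h := mfderiv_extChartAt_comp_mfderivWithin_extChartAt_symm (I := 𝓡 2) hy
  rw [ModelWithCorners.range_eq_univ, mfderivWithin_univ] at h
  exact congrArg (fun f => f (EuclideanSpace.single i (1 : ℝ) : Plane)) h

/-- The transition map from the chart centred at `x` to the chart centred at `x₀`. -/
noncomputable def transition (x x₀ : S) : Plane → Plane :=
  extChartAt (𝓡 2) x₀ ∘ (extChartAt (𝓡 2) x).symm

section Transition

variable {x x₀ : S} {y : Plane} (hy : y ∈ (extChartAt (𝓡 2) x).target)
  (hy₀ : (extChartAt (𝓡 2) x).symm y ∈ (extChartAt (𝓡 2) x₀).source)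

include hy hy₀

lemma contDiffAt_transition : ContDiffAt ℝ ∞ (transition x x₀) y :=
  ((contMDiffAt_chart hy₀).comp y (contMDiffAt_chart_symm x hy)).contDiffAt

lemma chart_symm_eventuallyEq :
    (extChartAt (𝓡 2) x).symm =ᶠ[𝓝 y] (extChartAt (𝓡 2) x₀).symm ∘ transition x x₀ := by
  have h := (contMDiffAt_chart_symm x hy).continuousAt.preimage_mem_nhds
    ((isOpen_extChartAt_source (I := 𝓡 2) x₀).mem_nhds hy₀)
  filter_upwards [h] with z hz
  exact ((extChartAt (𝓡 2) x₀).left_inv hz).symm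

/-- The chain rule for a change of charts, as an equality of tangent vectors over a point that has
two descriptions. -/
lemma sigma_mfderiv_chart_symm :
    (⟨(extChartAt (𝓡 2) x).symm y, mfderiv 𝓘(ℝ, Plane) (𝓡 2) (extChartAt (𝓡 2) x).symm y⟩ :
      Σ z : S, Plane →L[ℝ] TangentSpace (𝓡 2) z) =
    ⟨(extChartAt (𝓡 2) x₀).symm (transition x x₀ y),
      (mfderiv 𝓘(ℝ, Plane) (𝓡 2) (extChartAt (𝓡 2) x₀).symm (transition x x₀ y)).comp
        (fderiv ℝ (transition x x₀) y)⟩ := by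
  rw [sigma_mfderiv_congr (chart_symm_eventuallyEq hy hy₀)]
  refine Sigma.ext rfl (heq_of_eq ?_)
  have h2 : transition x x₀ y ∈ (extChartAt (𝓡 2) x₀).target :=
    (extChartAt (𝓡 2) x₀).map_source hy₀
  have := mfderiv_comp y (mdifferentiableAt_chart_symm x₀ h2)
    ((contDiffAt_transition hy hy₀).differentiableAt (by simp)).mdifferentiableAt
  rw [mfderiv_eq_fderiv] at this
  exact this

lemma OneForm.inChart_transition (α : OneForm S) :
    α.inChart x y = (α.inChart x₀ (transition x x₀ y)).compContinuousLinearMap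
      (fderiv ℝ (transition x x₀) y) := by
  have h := congrArg (fun p : Σ z : S, Plane →L[ℝ] TangentSpace (𝓡 2) z =>
    ContinuousAlternatingMap.ofSubsingleton ℝ Plane ℝ (0 : Fin 1) ((α p.1).comp p.2))
    (sigma_mfderiv_chart_symm hy hy₀)
  exact h

end Transition

/-- The exterior derivative can be computed in any chart. -/
lemma OneForm.d_eq_of_mem_source (α : OneForm S) {x₀ x : S}
    (hx : x ∈ (extChartAt (𝓡 2) x₀).source)
    (h : DifferentiableAt ℝ (α.inChart x₀) (extChartAt (𝓡 2) x₀ x)) :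
    α.d x = (extDeriv (α.inChart x₀) (extChartAt (𝓡 2) x₀ x)).compContinuousLinearMap
      (mfderiv (𝓡 2) 𝓘(ℝ, Plane) (extChartAt (𝓡 2) x₀) x) := by
  set y := extChartAt (𝓡 2) x x
  have hy : y ∈ (extChartAt (𝓡 2) x).target := mem_extChartAt_target x
  have hxy : (extChartAt (𝓡 2) x).symm y = x := extChartAt_to_inv x
  have hy₀ : (extChartAt (𝓡 2) x).symm y ∈ (extChartAt (𝓡 2) x₀).source := by rwa [hxy]
  have hτ : transition x x₀ y = extChartAt (𝓡 2) x₀ x :=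
    congrArg (extChartAt (𝓡 2) x₀) hxy
  have hev : α.inChart x =ᶠ[𝓝 y] fun z => (α.inChart x₀ (transition x x₀ z)).compContinuousLinearMap
      (fderiv ℝ (transition x x₀) z) := by
    have h1 := (isOpen_extChartAt_target (I := 𝓡 2) x).mem_nhds hy
    have h2 := (contMDiffAt_chart_symm x hy).continuousAt.preimage_mem_nhds
      ((isOpen_extChartAt_source (I := 𝓡 2) x₀).mem_nhds hy₀)
    filter_upwards [h1, h2] with z hz hz₀
    exact α.inChart_transition hz hz₀
  have hω : DifferentiableAt ℝ (α.inChart x₀) (transition x x₀ y) := by rwa [hτ]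
  have hp := extDeriv_pullback (r := ∞) hω (contDiffAt_transition hy hy₀)
    (by simpa using (ENat.LEInfty.out : (2 : ℕ∞ω) ≤ ∞))
  have hchain : mfderiv (𝓡 2) 𝓘(ℝ, Plane) (extChartAt (𝓡 2) x₀) x =
      (fderiv ℝ (transition x x₀) y).comp
        (mfderiv (𝓡 2) 𝓘(ℝ, Plane) (extChartAt (𝓡 2) x) x) := by
    have hloc : extChartAt (𝓡 2) x₀ =ᶠ[𝓝 x] transition x x₀ ∘ extChartAt (𝓡 2) x := by
      filter_upwards [extChartAt_source_mem_nhds (I := 𝓡 2) x] with z hz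
      exact congrArg (extChartAt (𝓡 2) x₀) ((extChartAt (𝓡 2) x).left_inv hz).symm
    have h3 := mfderiv_comp x
      ((contDiffAt_transition hy hy₀).differentiableAt (by simp)).mdifferentiableAt
      (mdifferentiableAt_chart (mem_extChartAt_source (I := 𝓡 2) x))
    rw [mfderiv_eq_fderiv] at h3
    rw [hloc.mfderiv_eq]
    exact h3
  rw [OneForm.d, hev.extDeriv_eq, hp, hτ, hchain]
  rfl

lemma OneForm.d_coordVec {α : OneForm S} {x₀ : S} {y : Plane}
    (hy : y ∈ (extChartAt (𝓡 2) x₀).target)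
    (h : ∀ i, DifferentiableAt ℝ (α.coeff x₀ i) y) :
    α.d ((extChartAt (𝓡 2) x₀).symm y) ![coordVec x₀ y 0, coordVec x₀ y 1] =
      fderiv ℝ (α.coeff x₀ 1) y (EuclideanSpace.single 0 1) -
        fderiv ℝ (α.coeff x₀ 0) y (EuclideanSpace.single 1 1) := by
  have hyy : extChartAt (𝓡 2) x₀ ((extChartAt (𝓡 2) x₀).symm y) = y :=
    (extChartAt (𝓡 2) x₀).right_inv hy
  rw [α.d_eq_of_mem_source ((extChartAt (𝓡 2) x₀).map_target hy)
    (by rw [hyy]; exact OneForm.differentiableAt_inChart h), hyy, ← OneForm.extDeriv_inChart h]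
  refine congrArg (extDeriv (α.inChart x₀) y) (funext fun i => ?_)
  fin_cases i
  · exact mfderiv_chart_coordVec x₀ hy 0
  · exact mfderiv_chart_coordVec x₀ hy 1

omit [IsManifold (𝓡 2) ∞ S] in
lemma tendsto_chart_symm (x : S) :
    Tendsto (extChartAt (𝓡 2) x).symm (𝓝 (extChartAt (𝓡 2) x x)) (𝓝 x) := by
  simpa [ContinuousAt] using continuousAt_extChartAt_symm (I := 𝓡 2) x

omit [IsManifold (𝓡 2) ∞ S] in
lemma OneForm.d_congr {α β : OneForm S} {x : S} (h : ∀ᶠ z in 𝓝 x, α z = β z) :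
    α.d x = β.d x := by
  have : α.inChart x =ᶠ[𝓝 (extChartAt (𝓡 2) x x)] β.inChart x := by
    filter_upwards [(tendsto_chart_symm x).eventually h] with z hz
    simp only [OneForm.inChart, hz]
  rw [OneForm.d, OneForm.d, this.extDeriv_eq]

end Charts

/-! ### The metric in coordinates -/

section MetricCoordinates

variable {S : Type*} [TopologicalSpace S] [ChartedSpace Plane S] [IsManifold (𝓡 2) ∞ S]

lemma contMDiffAt_coordVec (x₀ : S) (i : Fin 2) {y : Plane}
    (hy : y ∈ (extChartAt (𝓡 2) x₀).target) :
    ContMDiffAt 𝓘(ℝ, Plane) ((𝓡 2).prod 𝓘(ℝ, Plane)) ∞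
      (fun z => TotalSpace.mk' Plane ((extChartAt (𝓡 2) x₀).symm z) (coordVec x₀ z i)) y := by
  have hsrc {z : Plane} (hz : z ∈ (extChartAt (𝓡 2) x₀).target) :
      (extChartAt (𝓡 2) x₀).symm z ∈ (chartAt Plane x₀).source := by
    simpa using (extChartAt (𝓡 2) x₀).map_target hz
  rw [(trivializationAt Plane (TangentSpace (𝓡 2)) x₀).contMDiffAt_iff (IB := 𝓡 2)]
  · refine ⟨contMDiffAt_chart_symm x₀ hy, ?_⟩
    refine (contMDiffAt_const (c := (EuclideanSpace.single i 1 : Plane))).congr_of_eventuallyEq ?_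
    filter_upwards [(isOpen_extChartAt_target (I := 𝓡 2) x₀).mem_nhds hy] with z hz
    have h1 := TangentBundle.continuousLinearMapAt_trivializationAt (I := 𝓡 2) (hsrc hz)
    have h2 := mfderiv_chart_coordVec x₀ hz i
    rw [← h1] at h2
    refine Eq.trans ?_ h2
    have h3 : (extChartAt (𝓡 2) x₀).symm z ∈
        (trivializationAt Plane (TangentSpace (𝓡 2)) x₀).baseSet := by simpa using hsrc hz
    have h4 := (trivializationAt Plane (TangentSpace (𝓡 2)) x₀).continuousLinearMapAt_apply_of_mem
      (R := ℝ) h3 (coordVec x₀ z i)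
    exact h4.symm
  · rw [Trivialization.mem_source]
    simpa using hsrc hy

variable [RiemannianBundle (fun x : S => TangentSpace (𝓡 2) x)]

/-- The coefficient `g(∂ᵢ, ∂ⱼ)` of the metric in the chart centred at `x₀`. -/
noncomputable def metricCoeff (x₀ : S) (i j : Fin 2) (y : Plane) : ℝ :=
  inner ℝ (coordVec x₀ y i) (coordVec x₀ y j)

lemma contDiffAt_metricCoeff [IsContMDiffRiemannianBundle (𝓡 2) ∞ Plane
      (fun x : S => TangentSpace (𝓡 2) x)] (x₀ : S) (i j : Fin 2) {y : Plane}
    (hy : y ∈ (extChartAt (𝓡 2) x₀).target) : ContDiffAt ℝ ∞ (metricCoeff x₀ i j) y :=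
  ((contMDiffAt_coordVec x₀ i hy).inner_bundle (contMDiffAt_coordVec x₀ j hy)).contDiffAt

variable (o : ∀ x : S, Orientation ℝ (TangentSpace (𝓡 2) x) (Fin 2))

omit [IsManifold (𝓡 2) ∞ S] in
/-- The defining property of the Hodge star on 2-forms: `β = (*β) · (area form)`. -/
lemma starTwo_mul_areaForm (β : TwoForm S) (x : S) (u v : TangentSpace (𝓡 2) x) :
    starTwo o β x * (o x).areaForm u v = β x ![u, v] := by
  obtain ⟨c, hc⟩ := alternating_eq_smul_areaForm (o x) (β x)
  have hv : (EuclideanSpace.single 0 (1 : ℝ) : Plane) ≠ 0 := by simp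
  let e : TangentSpace (𝓡 2) x := (EuclideanSpace.single 0 (1 : ℝ) : Plane)
  have he : ‖e‖ ^ 2 ≠ 0 := pow_ne_zero 2 (norm_ne_zero_iff.2 hv)
  have : starTwo o β x = c := by
    have h : β x ![e, rot o x e] = c * ‖e‖ ^ 2 :=
      (hc e (rot o x e)).trans (congrArg (c * ·) (areaForm_self_rot (o x) e))
    exact (div_eq_iff he).2 h
  rw [this, hc]

/-- The coefficient `± √det g` of the area form in the chart centred at `x₀`. -/
noncomputable def areaCoeff (x₀ : S) (y : Plane) : ℝ :=
  (o ((extChartAt (𝓡 2) x₀).symm y)).areaForm (coordVec x₀ y 0) (coordVec x₀ y 1)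

omit [IsManifold (𝓡 2) ∞ S] in
lemma areaCoeff_sq (x₀ : S) (y : Plane) : areaCoeff o x₀ y ^ 2 =
    metricCoeff x₀ 0 0 y * metricCoeff x₀ 1 1 y - metricCoeff x₀ 0 1 y ^ 2 := by
  have := (o ((extChartAt (𝓡 2) x₀).symm y)).inner_sq_add_areaForm_sq
    (coordVec x₀ y 0) (coordVec x₀ y 1)
  simp only [areaCoeff, metricCoeff, real_inner_self_eq_norm_sq]
  linarith

omit [IsManifold (𝓡 2) ∞ S] in
lemma volDensity_eq_abs (x₀ : S) (y : Plane) : volDensity x₀ y = |areaCoeff o x₀ y| := by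
  rw [volDensity, ← Real.sqrt_sq_eq_abs, areaCoeff_sq, Matrix.det_fin_two]
  simp only [Matrix.of_apply, metricCoeff]
  rw [real_inner_comm (coordVec x₀ y 0) (coordVec x₀ y 1)]
  congr 1
  ring

omit [IsManifold (𝓡 2) ∞ S] in
/-- The area form of a surface pulled back by a linear map is a determinant. -/
lemma areaForm_comp (x : S) (M : Plane →L[ℝ] TangentSpace (𝓡 2) x) (p q : Plane) :
    (o x).areaForm (M p) (M q) =
      (o x).areaForm (M (EuclideanSpace.single 0 1)) (M (EuclideanSpace.single 1 1)) *
        (p 0 * q 1 - p 1 * q 0) := by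
  have h (p : Plane) : M p =
      p 0 • M (EuclideanSpace.single 0 1) + p 1 • M (EuclideanSpace.single 1 1) := by
    rw [← map_smul, ← map_smul, ← map_add]
    congr 1
    ext j; fin_cases j <;> simp
  rw [h p, h q]
  simp only [map_add, map_smul, LinearMap.add_apply, LinearMap.smul_apply, smul_eq_mul,
    Orientation.areaForm_apply_self]
  rw [(o x).areaForm_swap (M (EuclideanSpace.single 1 1))]
  ring

lemma areaCoeff_ne_zero (x₀ : S) {y : Plane} (hy : y ∈ (extChartAt (𝓡 2) x₀).target) :
    areaCoeff o x₀ y ≠ 0 := by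
  intro h0
  have hinv := isInvertible_mfderivWithin_extChartAt_symm (I := 𝓡 2) (x := x₀) hy
  rw [ModelWithCorners.range_eq_univ, mfderivWithin_univ] at hinv
  let x := (extChartAt (𝓡 2) x₀).symm y
  let v : TangentSpace (𝓡 2) x := (EuclideanSpace.single 0 (1 : ℝ) : Plane)
  obtain ⟨M, hM⟩ := hinv
  have hv : v ≠ 0 := by
    have : (EuclideanSpace.single 0 (1 : ℝ) : Plane) ≠ 0 := by simp
    exact this
  have h1 := areaForm_comp o x (mfderiv 𝓘(ℝ, Plane) (𝓡 2) (extChartAt (𝓡 2) x₀).symm y)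
    (M.symm v) (M.symm ((o x).rightAngleRotation v))
  have h2 : ∀ w, mfderiv 𝓘(ℝ, Plane) (𝓡 2) (extChartAt (𝓡 2) x₀).symm y (M.symm w) = w := by
    intro w
    rw [← hM]
    exact M.apply_symm_apply w
  have h3 : (o x).areaForm v ((o x).rightAngleRotation v) = areaCoeff o x₀ y * _ :=
    (congrArg₂ (fun a b => (o x).areaForm a b) (h2 v) (h2 _)).symm.trans h1
  rw [h0, zero_mul, areaForm_self_rot] at h3
  exact hv (norm_eq_zero.1 (pow_eq_zero_iff two_ne_zero |>.1 h3))

/-- `*dα` in coordinates. -/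
lemma starTwo_d_mul_areaCoeff {α : OneForm S} {x₀ : S} {y : Plane}
    (hy : y ∈ (extChartAt (𝓡 2) x₀).target)
    (h : ∀ i, DifferentiableAt ℝ (α.coeff x₀ i) y) :
    starTwo o α.d ((extChartAt (𝓡 2) x₀).symm y) * areaCoeff o x₀ y =
      fderiv ℝ (α.coeff x₀ 1) y (EuclideanSpace.single 0 1) -
        fderiv ℝ (α.coeff x₀ 0) y (EuclideanSpace.single 1 1) := by
  rw [areaCoeff, starTwo_mul_areaForm, OneForm.d_coordVec hy h]

omit [IsManifold (𝓡 2) ∞ S] in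
/-- `*α` in coordinates. -/
lemma coeff_starOne_mul_areaCoeff (α : OneForm S) (x₀ : S) (i : Fin 2) (y : Plane) :
    (starOne o α).coeff x₀ i y * areaCoeff o x₀ y =
      metricCoeff x₀ i 1 y * α.coeff x₀ 0 y - metricCoeff x₀ i 0 y * α.coeff x₀ 1 y := by
  set x := (extChartAt (𝓡 2) x₀).symm y
  have h := areaForm_smul_eq (o := o x) (u := coordVec x₀ y 0) (v := coordVec x₀ y 1)
    ((o x).rightAngleRotation (coordVec x₀ y i))
  rw [Orientation.areaForm_rightAngleRotation_left, Orientation.areaForm_rightAngleRotation_right,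
    real_inner_comm] at h
  have h2 := congrArg (α x) h
  simp only [map_smul, map_add, smul_eq_mul] at h2
  have h3 : (starOne o α).coeff x₀ i y =
    -(α x ((o x).rightAngleRotation (coordVec x₀ y i))) := rfl
  rw [h3]
  simp only [OneForm.coeff, areaCoeff, metricCoeff]
  rw [real_inner_comm (coordVec x₀ y 0) (coordVec x₀ y i),
    real_inner_comm (coordVec x₀ y 1) (coordVec x₀ y i)]
  linarith

variable {o}

omit [IsManifold (𝓡 2) ∞ S] in
/-- Near the centre of a chart, the coefficient of the area form is `√det g` up to a constant
sign. -/
lemma IsOrientation.eventually_areaCoeff (ho : IsOrientation o) (x₀ : S) :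
    ∃ ε : ℝ, (ε = 1 ∨ ε = -1) ∧ ∀ᶠ y in 𝓝 (extChartAt (𝓡 2) x₀ x₀),
      areaCoeff o x₀ y = ε * volDensity x₀ y := by
  have ht := (isOpen_extChartAt_target (I := 𝓡 2) x₀).mem_nhds (mem_extChartAt_target x₀)
  by_cases hs : 0 < areaCoeff o x₀ (extChartAt (𝓡 2) x₀ x₀)
  · refine ⟨1, Or.inl rfl, ?_⟩
    filter_upwards [ho x₀] with y hy
    have : 0 < areaCoeff o x₀ y := hy.2 hs
    rw [volDensity_eq_abs o, abs_of_pos this, one_mul]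
  · refine ⟨-1, Or.inr rfl, ?_⟩
    filter_upwards [ho x₀, ht] with y hy hyt
    have : areaCoeff o x₀ y ≤ 0 := not_lt.1 fun h => hs (hy.1 h)
    rw [volDensity_eq_abs o, abs_of_nonpos this]
    ring

variable [IsContMDiffRiemannianBundle (𝓡 2) ∞ Plane (fun x : S => TangentSpace (𝓡 2) x)]

variable (o) in
include o in
lemma contDiffAt_volDensity (x₀ : S) {y : Plane} (hy : y ∈ (extChartAt (𝓡 2) x₀).target) :
    ContDiffAt ℝ ∞ (volDensity x₀) y := by
  have h : volDensity x₀ = fun z => Real.sqrt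
      (metricCoeff x₀ 0 0 z * metricCoeff x₀ 1 1 z - metricCoeff x₀ 0 1 z ^ 2) := by
    funext z
    rw [volDensity_eq_abs o, ← Real.sqrt_sq_eq_abs, areaCoeff_sq]
  rw [h]
  have hne : metricCoeff x₀ 0 0 y * metricCoeff x₀ 1 1 y - metricCoeff x₀ 0 1 y ^ 2 ≠ 0 := by
    rw [← areaCoeff_sq o]
    exact pow_ne_zero 2 (areaCoeff_ne_zero o x₀ hy)
  exact (((contDiffAt_metricCoeff x₀ 0 0 hy).mul (contDiffAt_metricCoeff x₀ 1 1 hy)).sub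
    ((contDiffAt_metricCoeff x₀ 0 1 hy).pow 2)).sqrt hne

lemma IsOrientation.eventually_contDiffAt_areaCoeff (ho : IsOrientation o) (x₀ : S) :
    ∀ᶠ y in 𝓝 (extChartAt (𝓡 2) x₀ x₀), ContDiffAt ℝ ∞ (areaCoeff o x₀) y := by
  have ht := (isOpen_extChartAt_target (I := 𝓡 2) x₀).mem_nhds (mem_extChartAt_target x₀)
  obtain ⟨ε, -, hε⟩ := ho.eventually_areaCoeff x₀
  filter_upwards [hε.eventually_nhds, ht] with y hy hyt
  exact (contDiffAt_const.mul (contDiffAt_volDensity o x₀ hyt)).congr_of_eventuallyEq hy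

end MetricCoordinates

/-! ### The Riemannian volume -/

section Volume

variable {S : Type*} [TopologicalSpace S] [ChartedSpace Plane S] [IsManifold (𝓡 2) ∞ S]
  [MeasurableSpace S] [BorelSpace S]
  [RiemannianBundle (fun x : S => TangentSpace (𝓡 2) x)]
  (o : ∀ x : S, Orientation ℝ (TangentSpace (𝓡 2) x) (Fin 2))

omit [IsManifold (𝓡 2) ∞ S] [RiemannianBundle (fun x : S => TangentSpace (𝓡 2) x)] in
lemma measurableSet_target_inter_preimage (x₀ : S) {E : Set S} (hE : MeasurableSet E) :
    MeasurableSet ((extChartAt (𝓡 2) x₀).target ∩ (extChartAt (𝓡 2) x₀).symm ⁻¹' E) := by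
  have ht := (isOpen_extChartAt_target (I := 𝓡 2) x₀).measurableSet
  have hc : Measurable ((extChartAt (𝓡 2) x₀).target.domRestrict (extChartAt (𝓡 2) x₀).symm) :=
    (continuousOn_extChartAt_symm (I := 𝓡 2) x₀).domRestrict.measurable
  have := ht.subtype_image (hc hE)
  convert this using 1
  ext y
  simp [and_comm]

omit [IsManifold (𝓡 2) ∞ S] in
lemma aemeasurable_chart_symm (x₀ : S) :
    AEMeasurable (extChartAt (𝓡 2) x₀).symm
      (((volume : Measure Plane).restrict (extChartAt (𝓡 2) x₀).target).withDensity
        (fun y => ENNReal.ofReal (volDensity x₀ y))) :=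
  ((continuousOn_extChartAt_symm (I := 𝓡 2) x₀).aemeasurable
    (isOpen_extChartAt_target (I := 𝓡 2) x₀).measurableSet).mono_ac
    (withDensity_absolutelyContinuous _ _)

omit [IsManifold (𝓡 2) ∞ S] in
lemma chartVol_apply (x₀ : S) {E : Set S} (hE : MeasurableSet E) :
    chartVol x₀ E = ∫⁻ y in (extChartAt (𝓡 2) x₀).target ∩ (extChartAt (𝓡 2) x₀).symm ⁻¹' E,
      ENNReal.ofReal (volDensity x₀ y) := by
  rw [chartVol, Measure.map_apply_of_aemeasurable (aemeasurable_chart_symm x₀) hE,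
    withDensity_apply', Measure.restrict_restrict'
      (isOpen_extChartAt_target (I := 𝓡 2) x₀).measurableSet, inter_comm]

omit [IsManifold (𝓡 2) ∞ S] in
lemma chartVol_compl_source (x₀ : S) : chartVol x₀ (extChartAt (𝓡 2) x₀).sourceᶜ = 0 := by
  rw [chartVol_apply x₀ (isOpen_extChartAt_source (I := 𝓡 2) x₀).measurableSet.compl]
  have : (extChartAt (𝓡 2) x₀).target ∩
      (extChartAt (𝓡 2) x₀).symm ⁻¹' (extChartAt (𝓡 2) x₀).sourceᶜ = ∅ := by
    ext y
    simp only [mem_inter_iff, mem_preimage, mem_compl_iff, mem_empty_iff_false, iff_false,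
      not_and, not_not]
    exact fun hy => (extChartAt (𝓡 2) x₀).map_target hy
  rw [this]
  simp

lemma det_plane (T : Plane →L[ℝ] Plane) : T.det =
    T (EuclideanSpace.single 0 1) 0 * T (EuclideanSpace.single 1 1) 1 -
      T (EuclideanSpace.single 0 1) 1 * T (EuclideanSpace.single 1 1) 0 := by
  rw [ContinuousLinearMap.det,
    ← LinearMap.det_toMatrix (EuclideanSpace.basisFun (Fin 2) ℝ).toBasis, Matrix.det_fin_two]
  simp [LinearMap.toMatrix_apply]
  ring

omit [MeasurableSpace S] [BorelSpace S] in
include o in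
lemma volDensity_transition {x x₀ : S} {y : Plane} (hy : y ∈ (extChartAt (𝓡 2) x).target)
    (hy₀ : (extChartAt (𝓡 2) x).symm y ∈ (extChartAt (𝓡 2) x₀).source) :
    volDensity x y = |(fderiv ℝ (transition x x₀) y).det| *
      volDensity x₀ (transition x x₀ y) := by
  have h := congrArg (fun p : Σ z : S, Plane →L[ℝ] TangentSpace (𝓡 2) z =>
    (o p.1).areaForm (p.2 (EuclideanSpace.single 0 1)) (p.2 (EuclideanSpace.single 1 1)))
    (sigma_mfderiv_chart_symm hy hy₀)
  have h2 := areaForm_comp o _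
    (mfderiv 𝓘(ℝ, Plane) (𝓡 2) (extChartAt (𝓡 2) x₀).symm (transition x x₀ y))
    (fderiv ℝ (transition x x₀) y (EuclideanSpace.single 0 1))
    (fderiv ℝ (transition x x₀) y (EuclideanSpace.single 1 1))
  have h3 : areaCoeff o x y = areaCoeff o x₀ (transition x x₀ y) *
      (fderiv ℝ (transition x x₀) y).det := by
    rw [det_plane]
    exact h.trans h2
  rw [volDensity_eq_abs o, volDensity_eq_abs o, h3, abs_mul, mul_comm]

include o in
/-- The volumes of two charts agree on their overlap. -/
lemma chartVol_eq (x x₀ : S) {E : Set S} (hE : MeasurableSet E)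
    (hx : E ⊆ (extChartAt (𝓡 2) x).source) (hx₀ : E ⊆ (extChartAt (𝓡 2) x₀).source) :
    chartVol x E = chartVol x₀ E := by
  rw [chartVol_apply x hE, chartVol_apply x₀ hE]
  set A := (extChartAt (𝓡 2) x).target ∩ (extChartAt (𝓡 2) x).symm ⁻¹' E with hA
  have hAm : MeasurableSet A := measurableSet_target_inter_preimage x hE
  have himg : (extChartAt (𝓡 2) x₀).target ∩ (extChartAt (𝓡 2) x₀).symm ⁻¹' E =
      transition x x₀ '' A := by
    ext z
    constructor
    · rintro ⟨hz, hzE⟩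
      refine ⟨extChartAt (𝓡 2) x ((extChartAt (𝓡 2) x₀).symm z),
        ⟨(extChartAt (𝓡 2) x).map_source (hx hzE), ?_⟩, ?_⟩
      · rw [mem_preimage, (extChartAt (𝓡 2) x).left_inv (hx hzE)]
        exact hzE
      · rw [transition, Function.comp_apply, (extChartAt (𝓡 2) x).left_inv (hx hzE),
          (extChartAt (𝓡 2) x₀).right_inv hz]
    · rintro ⟨y, ⟨hy, hyE⟩, rfl⟩
      refine ⟨(extChartAt (𝓡 2) x₀).map_source (hx₀ hyE), ?_⟩
      rw [mem_preimage, transition, Function.comp_apply, (extChartAt (𝓡 2) x₀).left_inv (hx₀ hyE)]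
      exact hyE
  have hinj : InjOn (transition x x₀) A := by
    intro y hy z hz h
    have h1 := (extChartAt (𝓡 2) x₀).injOn (hx₀ hy.2) (hx₀ hz.2) h
    exact (extChartAt (𝓡 2) x).symm.injOn hy.1 hz.1 h1
  rw [himg, lintegral_image_eq_lintegral_abs_det_fderiv_mul volume hAm
    (f' := fderiv ℝ (transition x x₀))
    (fun y hy => ((contDiffAt_transition hy.1 (hx₀ hy.2)).differentiableAt
      (by simp)).hasFDerivAt.hasFDerivWithinAt) hinj]
  refine setLIntegral_congr_fun hAm fun y hy => ?_
  rw [volDensity_transition o hy.1 (hx₀ hy.2), ENNReal.ofReal_mul (abs_nonneg _)]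

include o in
/-- The Riemannian volume agrees with the volume of a chart on its domain. -/
lemma riemannianVolume_restrict_source (x₀ : S) :
    (riemannianVolume S).restrict (extChartAt (𝓡 2) x₀).source = chartVol x₀ := by
  set U := (extChartAt (𝓡 2) x₀).source
  have hU : MeasurableSet U := (isOpen_extChartAt_source (I := 𝓡 2) x₀).measurableSet
  have hzero (E : Set S) : chartVol x₀ (E \ U) = 0 :=
    measure_mono_null (fun z hz => hz.2) (chartVol_compl_source x₀)
  -- the volume of any chart is at most this measure, which is `chartVol x₀` on `U`
  have hle : riemannianVolume S ≤ chartVol x₀ + (riemannianVolume S).restrict Uᶜ := by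
    refine iSup_le fun x => Measure.le_iff.2 fun E hE => ?_
    set V := (extChartAt (𝓡 2) x).source
    have hV : MeasurableSet V := (isOpen_extChartAt_source (I := 𝓡 2) x).measurableSet
    have h1 : chartVol x (E ∩ U) ≤ chartVol x₀ E := by
      have hn : chartVol x ((E ∩ U) \ V) = 0 :=
        measure_mono_null (fun z hz => hz.2) (chartVol_compl_source x)
      rw [← measure_inter_add_sdiff (E ∩ U) hV, hn, add_zero,
        chartVol_eq o x x₀ ((hE.inter hU).inter hV) inter_subset_right
          (inter_subset_left.trans inter_subset_right)]
      exact measure_mono (inter_subset_left.trans inter_subset_left)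
    have h2 : chartVol x (E \ U) ≤ (riemannianVolume S).restrict Uᶜ E := by
      rw [Measure.restrict_apply hE]
      exact Measure.le_iff'.1 (le_iSup (fun x : S => chartVol x) x) _
    rw [← measure_inter_add_sdiff E hU, Measure.add_apply]
    exact add_le_add h1 h2
  refine le_antisymm ?_ ?_
  · refine Measure.le_iff.2 fun E hE => ?_
    rw [Measure.restrict_apply hE]
    refine (Measure.le_iff'.1 hle _).trans ?_
    rw [Measure.add_apply, Measure.restrict_apply (hE.inter hU), inter_assoc, inter_compl_self,
      inter_empty, measure_empty, add_zero]
    exact measure_mono inter_subset_left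
  · refine Measure.le_iff.2 fun E hE => ?_
    rw [Measure.restrict_apply hE, ← measure_inter_add_sdiff E hU, hzero, add_zero]
    exact Measure.le_iff'.1 (le_iSup (fun x : S => chartVol x) x₀) _

variable [IsContMDiffRiemannianBundle (𝓡 2) ∞ Plane (fun x : S => TangentSpace (𝓡 2) x)]

include o in
lemma isLocallyFiniteMeasure_riemannianVolume : IsLocallyFiniteMeasure (riemannianVolume S) := by
  refine ⟨fun x₀ => ?_⟩
  have ht := (isOpen_extChartAt_target (I := 𝓡 2) x₀).mem_nhds (mem_extChartAt_target x₀)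
  set y₀ := extChartAt (𝓡 2) x₀ x₀
  have hcont : ContinuousAt (volDensity x₀) y₀ :=
    (contDiffAt_volDensity o x₀ (mem_extChartAt_target x₀)).continuousAt
  have hb : ∀ᶠ y in 𝓝 y₀, volDensity x₀ y < volDensity x₀ y₀ + 1 :=
    hcont.eventually_lt_const (lt_add_one _)
  obtain ⟨r, hr, hball⟩ := Metric.mem_nhds_iff.1 (inter_mem ht hb)
  have hEo : IsOpen ((extChartAt (𝓡 2) x₀).source ∩ extChartAt (𝓡 2) x₀ ⁻¹' Metric.ball y₀ r) :=
    isOpen_extChartAt_preimage' x₀ Metric.isOpen_ball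
  refine ⟨(extChartAt (𝓡 2) x₀).source ∩ extChartAt (𝓡 2) x₀ ⁻¹' Metric.ball y₀ r,
    hEo.mem_nhds ⟨mem_extChartAt_source x₀, Metric.mem_ball_self hr⟩, ?_⟩
  have hsub : (extChartAt (𝓡 2) x₀).target ∩ (extChartAt (𝓡 2) x₀).symm ⁻¹'
      ((extChartAt (𝓡 2) x₀).source ∩ extChartAt (𝓡 2) x₀ ⁻¹' Metric.ball y₀ r) ⊆
      Metric.ball y₀ r := by
    rintro y ⟨hy, -, hyb⟩
    rwa [mem_preimage, (extChartAt (𝓡 2) x₀).right_inv hy] at hyb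
  rw [← inter_eq_self_of_subset_left (inter_subset_left :
      (extChartAt (𝓡 2) x₀).source ∩ extChartAt (𝓡 2) x₀ ⁻¹' Metric.ball y₀ r ⊆ _),
    ← Measure.restrict_apply hEo.measurableSet, riemannianVolume_restrict_source o,
    chartVol_apply x₀ hEo.measurableSet]
  calc _ ≤ ∫⁻ y in Metric.ball y₀ r, ENNReal.ofReal (volDensity x₀ y) := lintegral_mono_set hsub
    _ ≤ ∫⁻ y in Metric.ball y₀ r, ENNReal.ofReal (volDensity x₀ y₀ + 1) :=
      setLIntegral_mono' measurableSet_ball fun y hy =>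
        ENNReal.ofReal_le_ofReal (hball hy).2.le
    _ < ⊤ := by
      rw [setLIntegral_const]
      exact ENNReal.mul_lt_top ENNReal.ofReal_lt_top measure_ball_lt_top

include o in
lemma integral_eq_of_support_subset {x₀ : S} {f : S → ℝ} (hf : Measurable f)
    (hs : Function.support f ⊆ (extChartAt (𝓡 2) x₀).source) :
    ∫ x, f x ∂(riemannianVolume S) = ∫ y in (extChartAt (𝓡 2) x₀).target,
      volDensity x₀ y * f ((extChartAt (𝓡 2) x₀).symm y) := by
  have ht := (isOpen_extChartAt_target (I := 𝓡 2) x₀).measurableSet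
  rw [← setIntegral_eq_integral_of_forall_compl_eq_zero
    (s := (extChartAt (𝓡 2) x₀).source) (fun x hx => Function.notMem_support.1 fun h => hx (hs h)),
    riemannianVolume_restrict_source o, chartVol,
    integral_map (aemeasurable_chart_symm x₀) hf.aestronglyMeasurable,
    integral_withDensity_eq_integral_toReal_smul₀ _ (by simp)]
  · refine integral_congr_ae (Eventually.of_forall fun y => ?_)
    have h0 : 0 ≤ volDensity x₀ y := Real.sqrt_nonneg _
    simp only [ENNReal.toReal_ofReal h0, smul_eq_mul]
  · have hc : ContinuousOn (volDensity x₀) (extChartAt (𝓡 2) x₀).target := fun y hy =>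
      (contDiffAt_volDensity o x₀ hy).continuousAt.continuousWithinAt
    exact (hc.aemeasurable ht).ennreal_ofReal

end Volume

/-! ### Stokes' theorem -/

lemma integral_fderiv_eq_zero_of_hasCompactSupport {f : Plane → ℝ} (hf : ContDiff ℝ 1 f)
    (hc : HasCompactSupport f) (v : Plane) : ∫ y, fderiv ℝ f y v = 0 := by
  have h1 : Integrable (fun y => fderiv ℝ f y v) :=
    ((hf.continuous_fderiv one_ne_zero).clm_apply continuous_const).integrable_of_hasCompactSupport
      ((hc.fderiv ℝ).comp_left (g := fun T : Plane →L[ℝ] ℝ => T v) rfl)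
  have h := integral_mul_fderiv_eq_neg_fderiv_mul_of_integrable (μ := volume)
    (f := fun _ => (1 : ℝ)) (g := f) (v := v) (by simp) (by simpa using h1)
    (by simpa using hf.continuous.integrable_of_hasCompactSupport hc)
    (fun _ _ => differentiableAt_const _)
    (fun y _ => (hf.differentiable one_ne_zero) y)
  simpa using h

section Stokes

variable {S : Type*} [TopologicalSpace S] [ChartedSpace Plane S]

/-- A 1-form of class `C¹`: in the chart centred at any point, its coefficients are of class `C¹`
near that point. -/
def OneForm.IsC1 (α : OneForm S) : Prop :=
  ∀ (x₀ : S) (i : Fin 2), ∀ᶠ y in 𝓝 (extChartAt (𝓡 2) x₀ x₀), ContDiffAt ℝ 1 (α.coeff x₀ i) y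

lemma OneForm.IsC1.zero : (0 : OneForm S).IsC1 := fun _ _ =>
  Eventually.of_forall fun _ => (contDiffAt_const (c := (0 : ℝ)) : _)

lemma OneForm.IsC1.add {α β : OneForm S} (hα : α.IsC1) (hβ : β.IsC1) : (α + β).IsC1 :=
  fun x₀ i => by
    filter_upwards [hα x₀ i, hβ x₀ i] with y h1 h2
    exact h1.add h2

lemma OneForm.IsC1.differentiableAt {α : OneForm S} (hα : α.IsC1) (x : S) (i : Fin 2) :
    DifferentiableAt ℝ (α.coeff x i) (extChartAt (𝓡 2) x x) :=
  (hα x i).self_of_nhds.differentiableAt one_ne_zero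

lemma OneForm.d_add {α β : OneForm S} {x : S}
    (hα : ∀ i, DifferentiableAt ℝ (α.coeff x i) (extChartAt (𝓡 2) x x))
    (hβ : ∀ i, DifferentiableAt ℝ (β.coeff x i) (extChartAt (𝓡 2) x x)) :
    (α + β).d x = α.d x + β.d x := by
  have h : (α + β).inChart x = α.inChart x + β.inChart x := by
    funext y
    rw [Pi.add_apply]
    ext v
    rfl
  simp only [OneForm.d, h, extDeriv_add (OneForm.differentiableAt_inChart hα)
    (OneForm.differentiableAt_inChart hβ)]
  rfl

lemma OneForm.d_smul (c : ℝ) (α : OneForm S) (x : S) : (c • α).d x = c • α.d x := by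
  have h : (c • α).inChart x = c • α.inChart x := by
    funext y
    rw [Pi.smul_apply]
    ext v
    rfl
  simp only [OneForm.d, h, extDeriv_smul]
  rfl

lemma OneForm.d_zero (x : S) : (0 : OneForm S).d x = 0 := by
  simpa using OneForm.d_smul 0 (0 : OneForm S) x

variable [IsManifold (𝓡 2) ∞ S]

lemma OneForm.IsC1.smul {α : OneForm S} (hα : α.IsC1) {f : S → ℝ}
    (hf : ContMDiff (𝓡 2) 𝓘(ℝ, ℝ) ∞ f) : OneForm.IsC1 (fun x => f x • α x) := fun x₀ i => by
  have ht := (isOpen_extChartAt_target (I := 𝓡 2) x₀).mem_nhds (mem_extChartAt_target x₀)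
  filter_upwards [hα x₀ i, ht] with y h1 hy
  have h2 : ContDiffAt ℝ 1 (fun z => f ((extChartAt (𝓡 2) x₀).symm z)) y :=
    ((hf.contMDiffAt.comp y (contMDiffAt_chart_symm x₀ hy)).contDiffAt).of_le (by simp)
  exact h2.mul h1

variable [RiemannianBundle (fun x : S => TangentSpace (𝓡 2) x)]
  {o : ∀ x : S, Orientation ℝ (TangentSpace (𝓡 2) x) (Fin 2)}

omit [IsManifold (𝓡 2) ∞ S] in
lemma starTwo_zero_apply {β : TwoForm S} {x : S} (h : β x = 0) : starTwo o β x = 0 := by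
  simp [starTwo, h]

omit [IsManifold (𝓡 2) ∞ S] in
lemma starTwo_add_apply {β γ δ : TwoForm S} {x : S} (h : δ x = β x + γ x) :
    starTwo o δ x = starTwo o β x + starTwo o γ x := by
  simp [starTwo, h, add_div]

variable [IsContMDiffRiemannianBundle (𝓡 2) ∞ Plane (fun x : S => TangentSpace (𝓡 2) x)]

lemma OneForm.IsC1.continuous_starTwo_d {α : OneForm S} (hα : α.IsC1) (ho : IsOrientation o) :
    Continuous (starTwo o α.d) := by
  refine continuous_iff_continuousAt.2 fun x => ?_
  have ht := (isOpen_extChartAt_target (I := 𝓡 2) x).mem_nhds (mem_extChartAt_target x)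
  set y₀ := extChartAt (𝓡 2) x x
  let h : Plane → ℝ := fun y => (fderiv ℝ (α.coeff x 1) y (EuclideanSpace.single 0 1) -
    fderiv ℝ (α.coeff x 0) y (EuclideanSpace.single 1 1)) / areaCoeff o x y
  have hfd (i : Fin 2) (v : Plane) : ContinuousAt (fun y => fderiv ℝ (α.coeff x i) y v) y₀ :=
    (((hα x i).self_of_nhds.fderiv_right (m := 0) (by simp)).continuousAt).clm_apply
      continuousAt_const
  have hh : ContinuousAt h y₀ := ((hfd 1 _).sub (hfd 0 _)).div
    (ho.eventually_contDiffAt_areaCoeff x).self_of_nhds.continuousAt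
    (areaCoeff_ne_zero o x (mem_extChartAt_target x))
  have hev : ∀ᶠ y in 𝓝 y₀, starTwo o α.d ((extChartAt (𝓡 2) x).symm y) = h y := by
    filter_upwards [ht, hα x 0, hα x 1] with y hy h0 h1
    rw [eq_div_iff (areaCoeff_ne_zero o x hy)]
    refine starTwo_d_mul_areaCoeff o hy fun i => ?_
    fin_cases i
    · exact h0.differentiableAt one_ne_zero
    · exact h1.differentiableAt one_ne_zero
  have hcx : ContinuousAt (extChartAt (𝓡 2) x) x := continuousAt_extChartAt x
  refine (hh.comp hcx).congr ?_
  filter_upwards [hcx.eventually hev, extChartAt_source_mem_nhds (I := 𝓡 2) x] with z hz hzs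
  rw [(extChartAt (𝓡 2) x).left_inv hzs] at hz
  exact hz.symm

variable [MeasurableSpace S] [BorelSpace S]

/-- Stokes' theorem for a form supported in a small coordinate patch. -/
lemma OneForm.IsC1.integral_starTwo_d_eq_zero_of_support {α : OneForm S} (hα : α.IsC1)
    (ho : IsOrientation o) {x₀ : S} {V : Set Plane} (hV : IsOpen V)
    (hVt : V ⊆ (extChartAt (𝓡 2) x₀).target) {ε : ℝ} (hε : ε = 1 ∨ ε = -1)
    (hVε : ∀ y ∈ V, areaCoeff o x₀ y = ε * volDensity x₀ y)
    (hVα : ∀ y ∈ V, ∀ i, ContDiffAt ℝ 1 (α.coeff x₀ i) y)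
    {K : Set S} (hK : IsCompact K) (hKc : IsClosed K)
    (hKV : K ⊆ (extChartAt (𝓡 2) x₀).source ∩ extChartAt (𝓡 2) x₀ ⁻¹' V)
    (hKα : ∀ x ∉ K, α x = 0) :
    ∫ x, starTwo o α.d x ∂(riemannianVolume S) = 0 := by
  have hzero : ∀ x ∉ K, starTwo o α.d x = 0 := fun x hx => by
    refine starTwo_zero_apply ?_
    rw [← OneForm.d_zero x]
    refine OneForm.d_congr ?_
    filter_upwards [hKc.isOpen_compl.mem_nhds hx] with z hz using hKα z hz
  rw [integral_eq_of_support_subset o (hα.continuous_starTwo_d ho).measurable (x₀ := x₀)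
    (fun x hx => (hKV (by_contra fun h => hx (hzero x h))).1)]
  set K' := extChartAt (𝓡 2) x₀ '' K with hK'
  have hK'c : IsCompact K' := hK.image_of_continuousOn
    ((continuousOn_extChartAt x₀).mono fun x hx => (hKV hx).1)
  have hK'V : K' ⊆ V := by
    rintro _ ⟨x, hx, rfl⟩
    exact (hKV hx).2
  have hsymm {y : Plane} (hy : y ∈ (extChartAt (𝓡 2) x₀).target) (hyK : y ∉ K') :
      (extChartAt (𝓡 2) x₀).symm y ∉ K := fun h => hyK ⟨_, h, (extChartAt (𝓡 2) x₀).right_inv hy⟩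
  let b : Fin 2 → Plane → ℝ := fun i => (extChartAt (𝓡 2) x₀).target.indicator (α.coeff x₀ i)
  have hb0 (i : Fin 2) {y : Plane} (hy : y ∉ K') : b i y = 0 := by
    by_cases hyt : y ∈ (extChartAt (𝓡 2) x₀).target
    · simp only [b, indicator_of_mem hyt, OneForm.coeff]
      rw [hKα _ (hsymm hyt hy)]
      rfl
    · exact indicator_of_notMem hyt _
  have hb0' (i : Fin 2) {y : Plane} (hy : y ∉ K') : b i =ᶠ[𝓝 y] fun _ => 0 := by
    filter_upwards [hK'c.isClosed.isOpen_compl.mem_nhds hy] with z hz using hb0 i hz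
  have hbV (i : Fin 2) {y : Plane} (hy : y ∈ V) : b i =ᶠ[𝓝 y] α.coeff x₀ i := by
    filter_upwards [hV.mem_nhds hy] with z hz using indicator_of_mem (hVt hz) _
  have hbC (i : Fin 2) : ContDiff ℝ 1 (b i) := contDiff_iff_contDiffAt.2 fun y => by
    by_cases hy : y ∈ K'
    · exact (hVα y (hK'V hy) i).congr_of_eventuallyEq (hbV i (hK'V hy))
    · exact contDiffAt_const.congr_of_eventuallyEq (hb0' i hy)
  have hbs (i : Fin 2) : HasCompactSupport (b i) :=
    HasCompactSupport.intro hK'c fun y hy => hb0 i hy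
  have hfd (i : Fin 2) {y : Plane} (hy : y ∉ K') (v : Plane) : fderiv ℝ (b i) y v = 0 := by
    rw [(hb0' i hy).fderiv_eq]
    simp
  have hint (i : Fin 2) (v : Plane) : Integrable (fun y => fderiv ℝ (b i) y v) :=
    (((hbC i).continuous_fderiv one_ne_zero).clm_apply
      continuous_const).integrable_of_hasCompactSupport
      (((hbs i).fderiv ℝ).comp_left (g := fun T : Plane →L[ℝ] ℝ => T v) rfl)
  have hpt : ∀ y ∈ (extChartAt (𝓡 2) x₀).target,
      volDensity x₀ y * starTwo o α.d ((extChartAt (𝓡 2) x₀).symm y) =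
      ε * (fderiv ℝ (b 1) y (EuclideanSpace.single 0 1) -
        fderiv ℝ (b 0) y (EuclideanSpace.single 1 1)) := by
    intro y hy
    by_cases hyV : y ∈ V
    · rw [(hbV 0 hyV).fderiv_eq, (hbV 1 hyV).fderiv_eq, ← starTwo_d_mul_areaCoeff o hy
        fun i => (hVα y hyV i).differentiableAt one_ne_zero, hVε y hyV]
      rcases hε with rfl | rfl <;> ring
    · have hyK : y ∉ K' := fun h => hyV (hK'V h)
      rw [hfd 0 hyK, hfd 1 hyK, hzero _ (hsymm hy hyK)]
      simp
  rw [setIntegral_congr_fun (isOpen_extChartAt_target (I := 𝓡 2) x₀).measurableSet hpt,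
    setIntegral_eq_integral_of_forall_compl_eq_zero, integral_const_mul,
    integral_sub (hint 1 _) (hint 0 _),
    integral_fderiv_eq_zero_of_hasCompactSupport (hbC 1) (hbs 1),
    integral_fderiv_eq_zero_of_hasCompactSupport (hbC 0) (hbs 0)]
  · simp
  · intro y hy
    have hyK : y ∉ K' := fun h => hy (hVt (hK'V h))
    rw [hfd 0 hyK, hfd 1 hyK]
    simp

/-- Stokes' theorem: the integral of an exact 2-form over a closed surface vanishes. -/
theorem OneForm.IsC1.integral_starTwo_d_eq_zero [T2Space S] [CompactSpace S] {α : OneForm S}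
    (hα : α.IsC1) (ho : IsOrientation o) :
    ∫ x, starTwo o α.d x ∂(riemannianVolume S) = 0 := by
  have := isLocallyFiniteMeasure_riemannianVolume (S := S) o
  have hint {β : OneForm S} (hβ : β.IsC1) : Integrable (starTwo o β.d) (riemannianVolume S) :=
    (hβ.continuous_starTwo_d ho).integrable_of_hasCompactSupport
      (HasCompactSupport.of_compactSpace _)
  choose ε hε hε' using ho.eventually_areaCoeff
  have hnhds (x₀ : S) : ∃ V : Set Plane, IsOpen V ∧ extChartAt (𝓡 2) x₀ x₀ ∈ V ∧
      V ⊆ (extChartAt (𝓡 2) x₀).target ∧ (∀ y ∈ V, areaCoeff o x₀ y = ε x₀ * volDensity x₀ y) ∧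
      (∀ y ∈ V, ∀ i, ContDiffAt ℝ 1 (α.coeff x₀ i) y) := by
    have ht : ∀ᶠ y in 𝓝 (extChartAt (𝓡 2) x₀ x₀), y ∈ (extChartAt (𝓡 2) x₀).target :=
      (isOpen_extChartAt_target (I := 𝓡 2) x₀).mem_nhds (mem_extChartAt_target x₀)
    have h := ht.and ((hε' x₀).and (eventually_all.2 (hα x₀)))
    obtain ⟨V, hV, hVo, hxV⟩ := _root_.eventually_nhds_iff.1 h
    exact ⟨V, hVo, hxV, fun y hy => (hV y hy).1, fun y hy => (hV y hy).2.1,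
      fun y hy => (hV y hy).2.2⟩
  choose V hVo hxV hVt hVε hVα using hnhds
  let U : S → Set S := fun x₀ => (extChartAt (𝓡 2) x₀).source ∩ extChartAt (𝓡 2) x₀ ⁻¹' V x₀
  obtain ⟨ρ, hρ⟩ := SmoothPartitionOfUnity.exists_isSubordinate (𝓡 2) isClosed_univ U
    (fun x₀ => isOpen_extChartAt_preimage' x₀ (hVo x₀))
    (fun x _ => mem_iUnion.2 ⟨x, mem_extChartAt_source x, hxV x⟩)
  have hpiece (x₀ : S) : ∫ x, starTwo o (OneForm.d fun x => ρ x₀ x • α x) x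
      ∂(riemannianVolume S) = 0 := by
    refine (hα.smul (ρ x₀).contMDiff).integral_starTwo_d_eq_zero_of_support ho (hVo x₀) (hVt x₀)
      (hε x₀) (hVε x₀) (fun y hy i => ?_) (K := tsupport (ρ x₀))
      (isClosed_tsupport _).isCompact (isClosed_tsupport _) (hρ x₀) (fun x hx => ?_)
    · have h2 : ContDiffAt ℝ 1 (fun z => ρ x₀ ((extChartAt (𝓡 2) x₀).symm z)) y :=
        (((ρ x₀).contMDiff.contMDiffAt.comp y
          (contMDiffAt_chart_symm x₀ (hVt x₀ hy))).contDiffAt).of_le (by simp)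
      exact h2.mul (hVα x₀ y hy i)
    · rw [image_eq_zero_of_notMem_tsupport hx, zero_smul]
  have hsum (s : Finset S) : OneForm.IsC1 (fun x => (∑ i ∈ s, ρ i x) • α x) ∧
      ∫ x, starTwo o (OneForm.d fun x => (∑ i ∈ s, ρ i x) • α x) x ∂(riemannianVolume S) = 0 := by
    classical
    induction s using Finset.induction_on with
    | empty =>
      have h0 : (fun x => (∑ i ∈ (∅ : Finset S), ρ i x) • α x) = (0 : OneForm S) := by
        funext x
        simp
      rw [h0]
      refine ⟨OneForm.IsC1.zero, ?_⟩
      simp [starTwo_zero_apply (o := o) (OneForm.d_zero _)]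
    | insert i s hi ih =>
      have h1 := hα.smul (ρ i).contMDiff
      have h0 : (fun x => (∑ j ∈ insert i s, ρ j x) • α x) =
          (fun x => ρ i x • α x : OneForm S) + (fun x => (∑ j ∈ s, ρ j x) • α x : OneForm S) := by
        funext x
        rw [Finset.sum_insert hi, add_smul]
        rfl
      rw [h0]
      refine ⟨h1.add ih.1, ?_⟩
      rw [integral_congr_ae (Eventually.of_forall fun x =>
        starTwo_add_apply (o := o)
          (OneForm.d_add (h1.differentiableAt x) (ih.1.differentiableAt x))),
        integral_add (hint h1) (hint ih.1),
        hpiece, ih.2, add_zero]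
  have hfin := ρ.locallyFinite.finite_nonempty_of_compact
  have hα' : α = fun x => (∑ i ∈ hfin.toFinset, ρ i x) • α x := by
    funext x
    have h1 := ρ.sum_eq_one (mem_univ x)
    rw [finsum_eq_sum_of_support_subset (s := hfin.toFinset)] at h1
    · rw [h1, one_smul]
    · intro i hi
      rw [Finite.coe_toFinset]
      exact ⟨x, hi⟩
  rw [hα']
  exact (hsum _).2

end Stokes

/-! ### The Laplacian and the maximum principle -/

/-- The Hessian at a local maximum is negative semidefinite. -/
lemma fderiv_fderiv_nonpos_of_isLocalMax {F : Plane → ℝ} {y : Plane} (hF : ContDiffAt ℝ 2 F y)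
    (hmax : IsLocalMax F y) (v : Plane) : fderiv ℝ (fderiv ℝ F) y v v ≤ 0 := by
  by_contra! hpos
  let γ : ℝ → Plane := fun t => y + t • v
  have hγ (t : ℝ) : HasDerivAt γ v t := by
    simpa [γ] using! ((hasDerivAt_id t).smul_const v).const_add y
  have hγ0 : γ 0 = y := by simp [γ]
  have hγt : Tendsto γ (𝓝 0) (𝓝 y) := by
    have h := (hγ 0).continuousAt
    rwa [ContinuousAt, hγ0] at h
  have hd : ∀ᶠ z in 𝓝 y, DifferentiableAt ℝ F z :=
    (hF.eventually (by simp)).mono fun z hz => hz.differentiableAt (by simp)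
  have hderiv : deriv (F ∘ γ) =ᶠ[𝓝 0] fun t => fderiv ℝ F (γ t) v := by
    filter_upwards [hγt.eventually hd] with t ht
    exact (ht.hasFDerivAt.comp_hasDerivAt t (hγ t)).deriv
  have hderiv2 : deriv (deriv (F ∘ γ)) 0 = fderiv ℝ (fderiv ℝ F) y v v := by
    rw [hderiv.deriv_eq]
    have h1 : HasFDerivAt (fderiv ℝ F) (fderiv ℝ (fderiv ℝ F) y) (γ 0) := by
      rw [hγ0]
      exact ((hF.fderiv_right (m := 1) (by norm_num)).differentiableAt one_ne_zero).hasFDerivAt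
    have h2 := (h1.comp_hasDerivAt 0 (hγ 0)).clm_apply (hasDerivAt_const (0 : ℝ) v)
    simpa using h2.deriv
  have hmaxγ : IsLocalMax (F ∘ γ) 0 := by
    have := hγt.eventually hmax
    simpa [IsLocalMax, IsMaxFilter, hγ0] using this
  have hmin : IsLocalMin (F ∘ γ) 0 := isLocalMin_of_deriv_deriv_pos (by rwa [hderiv2])
    hmaxγ.deriv_eq_zero ((hd.self_of_nhds.continuousAt.comp_of_eq (hγ 0).continuousAt hγ0))
  have hconst : F ∘ γ =ᶠ[𝓝 0] fun _ => (F ∘ γ) 0 := by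
    filter_upwards [hmaxγ, hmin] with t h1 h2 using le_antisymm h1 h2
  have h0 : deriv (F ∘ γ) =ᶠ[𝓝 0] fun _ => 0 := by
    filter_upwards [hconst.eventually_nhds] with t ht
    rw [EventuallyEq.deriv_eq ht]
    simp
  have : deriv (deriv (F ∘ γ)) 0 = 0 := by
    rw [h0.deriv_eq]
    simp
  linarith

section Laplacian

variable {S : Type*} [TopologicalSpace S] [ChartedSpace Plane S] [IsManifold (𝓡 2) ∞ S]

lemma inChart_differential {f : S → ℝ} {x₀ : S} {y : Plane}
    (hy : y ∈ (extChartAt (𝓡 2) x₀).target)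
    (hf : MDifferentiableAt (𝓡 2) 𝓘(ℝ, ℝ) f ((extChartAt (𝓡 2) x₀).symm y)) :
    (differential f).inChart x₀ y = ContinuousAlternatingMap.ofSubsingleton ℝ Plane ℝ (0 : Fin 1)
      (fderiv ℝ (f ∘ (extChartAt (𝓡 2) x₀).symm) y) := by
  have h := mfderiv_comp y hf (mdifferentiableAt_chart_symm x₀ hy)
  rw [mfderiv_eq_fderiv] at h
  rw [h]
  rfl

lemma coeff_differential {f : S → ℝ} {x₀ : S} {y : Plane}
    (hy : y ∈ (extChartAt (𝓡 2) x₀).target)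
    (hf : MDifferentiableAt (𝓡 2) 𝓘(ℝ, ℝ) f ((extChartAt (𝓡 2) x₀).symm y)) (i : Fin 2) :
    (differential f).coeff x₀ i y =
      fderiv ℝ (f ∘ (extChartAt (𝓡 2) x₀).symm) y (EuclideanSpace.single i 1) := by
  rw [← OneForm.inChart_apply_single _ x₀ y (fun _ => EuclideanSpace.single i 1) i rfl,
    inChart_differential hy hf]
  rfl

lemma eventually_mdifferentiableAt_chart_symm {f : S → ℝ} {x : S}
    (hf : ContMDiffAt (𝓡 2) 𝓘(ℝ, ℝ) ∞ f x) :
    ∀ᶠ y in 𝓝 (extChartAt (𝓡 2) x x), y ∈ (extChartAt (𝓡 2) x).target ∧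
      MDifferentiableAt (𝓡 2) 𝓘(ℝ, ℝ) f ((extChartAt (𝓡 2) x).symm y) := by
  have h1 : ∀ᶠ z in 𝓝 x, ContMDiffAt (𝓡 2) 𝓘(ℝ, ℝ) 1 f z :=
    (contMDiffAt_iff_contMDiffAt_nhds (by simp)).1 (hf.of_le (by simp))
  filter_upwards [(tendsto_chart_symm x).eventually h1,
    (isOpen_extChartAt_target (I := 𝓡 2) x).mem_nhds (mem_extChartAt_target x)] with y hy hyt
  exact ⟨hyt, hy.mdifferentiableAt one_ne_zero⟩

lemma contDiffAt_comp_chart_symm {f : S → ℝ} {x : S} (hf : ContMDiffAt (𝓡 2) 𝓘(ℝ, ℝ) ∞ f x) :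
    ContDiffAt ℝ ∞ (f ∘ (extChartAt (𝓡 2) x).symm) (extChartAt (𝓡 2) x x) :=
  (hf.comp_of_eq (contMDiffAt_chart_symm x (mem_extChartAt_target x))
    (extChartAt_to_inv x)).contDiffAt

lemma d_differential {f : S → ℝ} {x : S} (hf : ContMDiffAt (𝓡 2) 𝓘(ℝ, ℝ) ∞ f x) :
    (differential f).d x = 0 := by
  set F := f ∘ (extChartAt (𝓡 2) x).symm
  have h : (differential f).inChart x =ᶠ[𝓝 (extChartAt (𝓡 2) x x)]
      extDeriv (fun y => ContinuousAlternatingMap.constOfIsEmpty ℝ Plane (Fin 0) (F y)) := by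
    filter_upwards [eventually_mdifferentiableAt_chart_symm hf] with y hy
    rw [inChart_differential hy.1 hy.2, extDeriv_constOfIsEmpty]
  have hF : ContDiffAt ℝ ∞ (fun y => ContinuousAlternatingMap.constOfIsEmpty ℝ Plane (Fin 0) (F y))
      (extChartAt (𝓡 2) x x) :=
    (ContinuousAlternatingMap.constOfIsEmptyLIE ℝ Plane ℝ (Fin 0)).contDiff.contDiffAt.comp _
      (contDiffAt_comp_chart_symm hf)
  rw [OneForm.d, h.extDeriv_eq,
    extDeriv_extDeriv_apply hF (by simpa using (ENat.LEInfty.out : (2 : ℕ∞ω) ≤ ∞))]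
  rfl

variable [RiemannianBundle (fun x : S => TangentSpace (𝓡 2) x)]
  {o : ∀ x : S, Orientation ℝ (TangentSpace (𝓡 2) x) (Fin 2)}

lemma eventually_coeff_starOne_differential {f : S → ℝ} {x : S}
    (hf : ContMDiffAt (𝓡 2) 𝓘(ℝ, ℝ) ∞ f x) (i : Fin 2) :
    (starOne o (differential f)).coeff x i =ᶠ[𝓝 (extChartAt (𝓡 2) x x)] fun y =>
      (metricCoeff x i 1 y *
          fderiv ℝ (f ∘ (extChartAt (𝓡 2) x).symm) y (EuclideanSpace.single 0 1) -
        metricCoeff x i 0 y *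
          fderiv ℝ (f ∘ (extChartAt (𝓡 2) x).symm) y (EuclideanSpace.single 1 1)) /
        areaCoeff o x y := by
  filter_upwards [eventually_mdifferentiableAt_chart_symm hf] with y hy
  rw [eq_div_iff (areaCoeff_ne_zero o x hy.1), coeff_starOne_mul_areaCoeff,
    coeff_differential hy.1 hy.2, coeff_differential hy.1 hy.2]

variable [IsContMDiffRiemannianBundle (𝓡 2) ∞ Plane (fun x : S => TangentSpace (𝓡 2) x)]

lemma contDiffAt_coeff_starOne_differential (ho : IsOrientation o) {f : S → ℝ} {x : S}
    (hf : ContMDiffAt (𝓡 2) 𝓘(ℝ, ℝ) ∞ f x) (i : Fin 2) :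
    ContDiffAt ℝ ∞ ((starOne o (differential f)).coeff x i) (extChartAt (𝓡 2) x x) := by
  refine ContDiffAt.congr_of_eventuallyEq ?_ (eventually_coeff_starOne_differential hf i)
  have hy := mem_extChartAt_target (I := 𝓡 2) x
  have hF (k : Fin 2) : ContDiffAt ℝ ∞ (fun y =>
      fderiv ℝ (f ∘ (extChartAt (𝓡 2) x).symm) y (EuclideanSpace.single k 1))
      (extChartAt (𝓡 2) x x) :=
    ((contDiffAt_comp_chart_symm hf).fderiv_right (m := ∞) (by simp)).clm_apply contDiffAt_const
  exact (((contDiffAt_metricCoeff x i 1 hy).mul (hF 0)).sub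
    ((contDiffAt_metricCoeff x i 0 hy).mul (hF 1))).div
    (ho.eventually_contDiffAt_areaCoeff x).self_of_nhds (areaCoeff_ne_zero o x hy)

lemma isC1_starOne_differential (ho : IsOrientation o) {f : S → ℝ}
    (hf : ContMDiff (𝓡 2) 𝓘(ℝ, ℝ) ∞ f) : (starOne o (differential f)).IsC1 := fun x i =>
  ((contDiffAt_coeff_starOne_differential ho hf.contMDiffAt i).of_le (m := 1) (by simp)).eventually
    (by simp)

/-- The Laplacian `Δ = -*d*d` is nonnegative at a local maximum: there `Δf` is, up to a
positive factor, minus the trace of the Hessian with respect to the metric. -/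
lemma laplacian_nonneg_of_isLocalMax (ho : IsOrientation o) {f : S → ℝ} {x : S}
    (hf : ContMDiffAt (𝓡 2) 𝓘(ℝ, ℝ) ∞ f x) (hmax : IsLocalMax f x) : 0 ≤ laplacian o f x := by
  set y := extChartAt (𝓡 2) x x
  have hy : y ∈ (extChartAt (𝓡 2) x).target := mem_extChartAt_target x
  have hxy : (extChartAt (𝓡 2) x).symm y = x := extChartAt_to_inv x
  set F := f ∘ (extChartAt (𝓡 2) x).symm with hF_def
  have hF : ContDiffAt ℝ ∞ F y := contDiffAt_comp_chart_symm hf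
  have hFmax : IsLocalMax F y := by
    have := (tendsto_chart_symm x).eventually hmax
    simpa only [IsLocalMax, IsMaxFilter, hF_def, Function.comp_apply, hxy] using this
  have hdF : fderiv ℝ F y = 0 := hFmax.fderiv_eq_zero
  set H := fderiv ℝ (fderiv ℝ F) y
  have hH : HasFDerivAt (fderiv ℝ F) H y :=
    ((hF.fderiv_right (m := ∞) (by simp)).differentiableAt (by simp)).hasFDerivAt
  -- the first derivatives of `F` vanish at `y`, so only the second ones survive
  have hc (i : Fin 2) (v : Plane) : fderiv ℝ ((starOne o (differential f)).coeff x i) y v =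
      (metricCoeff x i 1 y * H v (EuclideanSpace.single 0 1) -
        metricCoeff x i 0 y * H v (EuclideanSpace.single 1 1)) / areaCoeff o x y := by
    rw [(eventually_coeff_starOne_differential hf i).fderiv_eq]
    have hm (j : Fin 2) : DifferentiableAt ℝ (metricCoeff x i j) y :=
      (contDiffAt_metricCoeff x i j hy).differentiableAt (by simp)
    have ha : DifferentiableAt ℝ (areaCoeff o x) y :=
      (ho.eventually_contDiffAt_areaCoeff x).self_of_nhds.differentiableAt (by simp)
    have hFk (k : Fin 2) : HasFDerivAt (fun z => fderiv ℝ F z (EuclideanSpace.single k 1))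
        (H.flip (EuclideanSpace.single k 1)) y := by
      have := hH.clm_apply (hasFDerivAt_const (EuclideanSpace.single k (1 : ℝ) : Plane) y)
      simpa using this
    have hnum := (((hm 1).hasFDerivAt.mul (hFk 0)).sub ((hm 0).hasFDerivAt.mul (hFk 1)))
    have hw := areaCoeff_ne_zero o x hy
    have h := hnum.fun_mul (ha.inv hw).hasFDerivAt
    simp only [div_eq_mul_inv]
    refine (congrArg (fun T : Plane →L[ℝ] ℝ => T v) h.fderiv).trans ?_
    simp [hdF]
    ring
  have hw := areaCoeff_ne_zero o x hy
  have hstar := starTwo_d_mul_areaCoeff o hy fun i =>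
    (contDiffAt_coeff_starOne_differential ho hf i).differentiableAt (by simp)
  rw [hc, hc, hxy] at hstar
  set e₀ : Plane := EuclideanSpace.single 0 1
  set e₁ : Plane := EuclideanSpace.single 1 1
  set w := areaCoeff o x y
  have hsymm : metricCoeff x 1 0 y = metricCoeff x 0 1 y := real_inner_comm _ _
  have hwsq : w ^ 2 = metricCoeff x 0 0 y * metricCoeff x 1 1 y - metricCoeff x 0 1 y ^ 2 :=
    areaCoeff_sq o x y
  have hg0 : 0 ≤ metricCoeff x 0 0 y := real_inner_self_nonneg
  have hg : 0 < metricCoeff x 0 0 y := by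
    refine lt_of_le_of_ne hg0 fun h => ?_
    have : 0 < w ^ 2 := by positivity
    rw [hwsq, ← h] at this
    nlinarith [sq_nonneg (metricCoeff x 0 1 y)]
  have hF2 : ContDiffAt ℝ 2 F y := hF.of_le ENat.LEInfty.out
  have h0 : H e₀ e₀ ≤ 0 := fderiv_fderiv_nonpos_of_isLocalMax hF2 hFmax e₀
  have hz := fderiv_fderiv_nonpos_of_isLocalMax hF2 hFmax
    (metricCoeff x 0 1 y • e₀ - metricCoeff x 0 0 y • e₁)
  have hz' : H (metricCoeff x 0 1 y • e₀ - metricCoeff x 0 0 y • e₁)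
    (metricCoeff x 0 1 y • e₀ - metricCoeff x 0 0 y • e₁) ≤ 0 := hz
  simp only [map_sub, map_smul, sub_apply, smul_apply,
    smul_eq_mul] at hz'
  rw [hsymm] at hstar
  set g₀ := metricCoeff x 0 0 y
  set g₁ := metricCoeff x 0 1 y
  set g₂ := metricCoeff x 1 1 y
  -- the trace of the Hessian, times `g(∂₀, ∂₀)`, is a sum of two values of the Hessian
  have htr : g₀ * (starTwo o (starOne o (differential f)).d x * w ^ 2) =
      w ^ 2 * H e₀ e₀ + (g₁ * (g₁ * H e₀ e₀ - g₀ * H e₀ e₁) -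
        g₀ * (g₁ * H e₁ e₀ - g₀ * H e₁ e₁)) := by
    rw [pow_two, ← mul_assoc (starTwo o _ x), hstar, ← pow_two, hwsq]
    field_simp
    ring
  have hw2 : 0 < w ^ 2 := by positivity
  have hle : g₀ * (starTwo o (starOne o (differential f)).d x * w ^ 2) ≤ 0 := by
    rw [htr]
    nlinarith
  have h1 : starTwo o (starOne o (differential f)).d x * w ^ 2 ≤ 0 := by
    by_contra! h
    exact absurd hle (not_le.2 (mul_pos hg h))
  have h2 : starTwo o (starOne o (differential f)).d x ≤ 0 := by
    by_contra! h
    exact absurd h1 (not_le.2 (mul_pos h hw2))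
  exact neg_nonneg.2 h2

end Laplacian

/-! ### Hermitian lines -/

section HermitianLine

variable {V : Type*} [NormedAddCommGroup V] [InnerProductSpace ℂ V]

lemma real_inner_I_smul_left (a b : V) :
    inner ℝ (Complex.I • a) b = (inner ℂ a b : ℂ).im := by
  rw [real_inner_eq_re_inner ℂ, inner_smul_left]
  simp

lemma real_inner_I_smul_right (a b : V) :
    inner ℝ a (Complex.I • b) = -(inner ℂ a b : ℂ).im := by
  rw [real_inner_eq_re_inner ℂ, inner_smul_right]
  simp

lemma eq_inner_smul_of_norm_eq_one (hV : finrank ℂ V = 1) {e : V} (he : ‖e‖ = 1) (s : V) :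
    s = (inner ℂ e s : ℂ) • e := by
  have hne : e ≠ 0 := by
    rintro rfl
    simp at he
  obtain ⟨c, rfl⟩ := (finrank_eq_one_iff_of_nonzero' e hne).1 hV s
  rw [inner_smul_right, inner_self_eq_norm_sq_to_K, he]
  simp

lemma smul_eq_re_add_im (c : ℂ) (s : V) :
    c • s = (c.re : ℝ) • s + (c.im : ℝ) • (Complex.I • s) := by
  rw [← Complex.coe_smul c.re s, ← Complex.coe_smul c.im (Complex.I • s), smul_smul, ← add_smul,
    Complex.re_add_im]

end HermitianLine

/-! ### Unitary frames -/

section Frames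

variable {S : Type*} [TopologicalSpace S] [ChartedSpace Plane S]
  {L : S → Type*} [TopologicalSpace (Bundle.TotalSpace ℂ L)]
  [∀ x, NormedAddCommGroup (L x)] [∀ x, InnerProductSpace ℂ (L x)]
  [FiberBundle ℂ L] [VectorBundle ℂ ℂ L]

omit [ChartedSpace Plane S] in
variable (L) in
lemma finrank_fiber (x : S) : finrank ℂ (L x) = 1 := by
  rw [((trivializationAt ℂ L x).continuousLinearEquivAt ℂ x
    (mem_baseSet_trivializationAt ℂ L x)).toLinearEquiv.finrank_eq]
  simp

omit [ChartedSpace Plane S] in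
lemma trivialization_symm_one_ne_zero {x₀ y : S}
    (hy : y ∈ (trivializationAt ℂ L x₀).baseSet) : (trivializationAt ℂ L x₀).symm y 1 ≠ 0 := by
  intro h
  have h1 := (trivializationAt ℂ L x₀).apply_mk_symm hy (1 : ℂ)
  rw [h] at h1
  have h2 := ((trivializationAt ℂ L x₀).linear ℂ hy).map_smul 0 0
  simp only [smul_zero, zero_smul, h1] at h2
  simp at h2

omit [ChartedSpace Plane S] in
lemma norm_unitFrame {x₀ y : S} (hy : y ∈ (trivializationAt ℂ L x₀).baseSet) :
    ‖unitFrame L x₀ y‖ = 1 := by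
  have h := norm_ne_zero_iff.2 (trivialization_symm_one_ne_zero hy)
  rw [unitFrame, norm_smul, norm_inv, norm_norm, inv_mul_cancel₀ h]

omit [ChartedSpace Plane S] [∀ x, InnerProductSpace ℂ (L x)] [VectorBundle ℂ ℂ L] in
lemma eventually_mem_baseSet (x₀ : S) : ∀ᶠ y in 𝓝 x₀, y ∈ (trivializationAt ℂ L x₀).baseSet :=
  (trivializationAt ℂ L x₀).open_baseSet.mem_nhds (mem_baseSet_trivializationAt ℂ L x₀)

variable [ContMDiffVectorBundle ∞ ℂ L (𝓡 2)]

/-- Multiplication by `i` preserves smoothness of sections. -/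
lemma contMDiffAt_I_smul {σ : ∀ x, L x} {x : S}
    (hσ : ContMDiffAt (𝓡 2) ((𝓡 2).prod 𝓘(ℝ, ℂ)) ∞ (fun y => TotalSpace.mk' ℂ y (σ y)) x) :
    ContMDiffAt (𝓡 2) ((𝓡 2).prod 𝓘(ℝ, ℂ)) ∞
      (fun y => TotalSpace.mk' ℂ y (Complex.I • σ y)) x := by
  have hx := mem_baseSet_trivializationAt ℂ L x
  rw [(trivializationAt ℂ L x).contMDiffAt_section_iff hx] at hσ ⊢
  have h : ContMDiffAt (𝓡 2) 𝓘(ℝ, ℂ) ∞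
      (fun y => (Complex.I • ContinuousLinearMap.id ℝ ℂ)
        ((trivializationAt ℂ L x) ⟨y, σ y⟩).2) x :=
    (Complex.I • ContinuousLinearMap.id ℝ ℂ).contDiff.contMDiff.contMDiffAt.comp x hσ
  refine h.congr_of_eventuallyEq ?_
  filter_upwards [eventually_mem_baseSet (L := L) x] with y hy
  exact ((trivializationAt ℂ L x).linear ℂ hy).map_smul Complex.I (σ y)

variable [IsContMDiffRiemannianBundle (𝓡 2) ∞ ℂ L]

lemma contMDiffAt_unitFrame {x₀ y : S} (hy : y ∈ (trivializationAt ℂ L x₀).baseSet) :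
    ContMDiffAt (𝓡 2) ((𝓡 2).prod 𝓘(ℝ, ℂ)) ∞
      (fun z => TotalSpace.mk' ℂ z (unitFrame L x₀ z)) y := by
  set σ : ∀ z, L z := fun z => (trivializationAt ℂ L x₀).symm z 1
  have hσ : ContMDiffAt (𝓡 2) ((𝓡 2).prod 𝓘(ℝ, ℂ)) ∞ (fun z => TotalSpace.mk' ℂ z (σ z)) y := by
    rw [(trivializationAt ℂ L x₀).contMDiffAt_section_iff hy]
    refine (contMDiffAt_const (c := (1 : ℂ))).congr_of_eventuallyEq ?_
    filter_upwards [(trivializationAt ℂ L x₀).open_baseSet.mem_nhds hy] with z hz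
    rw [(trivializationAt ℂ L x₀).apply_mk_symm hz]
  have hn : ContMDiffAt (𝓡 2) 𝓘(ℝ, ℝ) ∞ (fun z => ‖σ z‖⁻¹) y := by
    have h1 : ContMDiffAt (𝓡 2) 𝓘(ℝ, ℝ) ∞ (fun z => inner ℝ (σ z) (σ z)) y := hσ.inner_bundle hσ
    have hne : inner ℝ (σ y) (σ y) ≠ 0 := by
      rw [real_inner_self_eq_norm_sq]
      exact pow_ne_zero 2 (norm_ne_zero_iff.2 (trivialization_symm_one_ne_zero hy))
    have h2 : ContDiffAt ℝ ∞ (fun t : ℝ => (Real.sqrt t)⁻¹) (inner ℝ (σ y) (σ y)) :=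
      (Real.contDiffAt_sqrt hne).inv (Real.sqrt_ne_zero'.2
        (lt_of_le_of_ne real_inner_self_nonneg hne.symm))
    have h3 := h2.contMDiffAt.comp y h1
    refine h3.congr_of_eventuallyEq (Eventually.of_forall fun z => ?_)
    simp only [Function.comp_apply]
    rw [real_inner_self_eq_norm_sq, Real.sqrt_sq (norm_nonneg _)]
  exact hn.smul_section hσ

end Frames

/-! ### Metric connexions -/

section Connexions

variable {S : Type*} [TopologicalSpace S] [ChartedSpace Plane S]
  {L : S → Type*} [TopologicalSpace (Bundle.TotalSpace ℂ L)]
  [∀ x, NormedAddCommGroup (L x)] [∀ x, InnerProductSpace ℂ (L x)]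
  [FiberBundle ℂ L]

lemma connForm_apply (D : CovariantDerivative (𝓡 2) ℂ L) (x₀ y : S)
    (v : TangentSpace (𝓡 2) y) :
    connForm D x₀ y v = inner ℝ (unitFrame L x₀ y) (Complex.I • D (unitFrame L x₀) y v) := rfl

variable [VectorBundle ℂ ℂ L] [ContMDiffVectorBundle ∞ ℂ L (𝓡 2)]
  [IsContMDiffRiemannianBundle (𝓡 2) ∞ ℂ L]

lemma mdifferentiableAt_unitFrame {x₀ y : S} (hy : y ∈ (trivializationAt ℂ L x₀).baseSet) :
    MDifferentiableAt (𝓡 2) ((𝓡 2).prod 𝓘(ℝ, ℂ))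
      (fun z => TotalSpace.mk' ℂ z (unitFrame L x₀ z)) y :=
  (contMDiffAt_unitFrame hy).mdifferentiableAt (by simp)

variable [IsManifold (𝓡 2) ∞ S]

variable {D D' : CovariantDerivative (𝓡 2) ℂ L}

/-- In a unitary frame `e`, `d_A e = -iAe`. -/
lemma IsMetricConnexion.I_smul_unitFrame (hD : IsMetricConnexion D) {x₀ y : S}
    (hy : y ∈ (trivializationAt ℂ L x₀).baseSet) (v : TangentSpace (𝓡 2) y) :
    Complex.I • D (unitFrame L x₀) y v = ((connForm D x₀ y v : ℝ) : ℂ) • unitFrame L x₀ y := by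
  have he := mdifferentiableAt_unitFrame hy
  have h := hD.metric.mvfderiv_inner_eq (fun _ => (v : Plane)) he he
  have hconst : (fun z => inner ℝ (unitFrame L x₀ z) (unitFrame L x₀ z)) =ᶠ[𝓝 y]
      fun _ => (1 : ℝ) := by
    filter_upwards [(trivializationAt ℂ L x₀).open_baseSet.mem_nhds hy] with z hz
    rw [real_inner_self_eq_norm_sq, norm_unitFrame hz, one_pow]
  have h0 : mfderiv (𝓡 2) 𝓘(ℝ, ℝ) (fun z => inner ℝ (unitFrame L x₀ z) (unitFrame L x₀ z)) y
      = 0 := by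
    rw [hconst.mfderiv_eq]
    exact mfderiv_const
  have h1 : inner ℝ (unitFrame L x₀ y) (D (unitFrame L x₀) y v) = 0 := by
    have h2 : (0 : ℝ) = inner ℝ (D (unitFrame L x₀) y v) (unitFrame L x₀ y) +
        inner ℝ (unitFrame L x₀ y) (D (unitFrame L x₀) y v) := by
      refine Eq.trans ?_ h
      rw [mvfderiv, h0]
      rfl
    rw [real_inner_comm] at h2
    linarith
  have h3 := eq_inner_smul_of_norm_eq_one (finrank_fiber L y) (norm_unitFrame hy)
    (Complex.I • D (unitFrame L x₀) y v)
  refine h3.trans ?_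
  congr 1
  apply Complex.ext
  · rw [Complex.ofReal_re, connForm_apply]
    exact (real_inner_eq_re_inner ℂ _ _).symm
  · rw [inner_smul_right]
    rw [real_inner_eq_re_inner ℂ] at h1
    simpa using h1

/-- The Leibniz rule for a complex-valued function. -/
lemma IsMetricConnexion.leibniz (hD : IsMetricConnexion D) {σ : ∀ x, L x} {f : S → ℂ} {x : S}
    (hσ : ContMDiffAt (𝓡 2) ((𝓡 2).prod 𝓘(ℝ, ℂ)) ∞ (fun y => TotalSpace.mk' ℂ y (σ y)) x)
    {f' : TangentSpace (𝓡 2) x →L[ℝ] ℂ} (hf : HasMFDerivAt (𝓡 2) 𝓘(ℝ, ℂ) f x f')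
    (v : TangentSpace (𝓡 2) x) :
    D (fun y => f y • σ y) x v = f x • D σ x v + f' v • σ x := by
  have hre : HasMFDerivAt (𝓡 2) 𝓘(ℝ, ℝ) (fun y => (f y).re) x (Complex.reCLM.comp f') :=
    Complex.reCLM.hasMFDerivAt.comp x hf
  have him : HasMFDerivAt (𝓡 2) 𝓘(ℝ, ℝ) (fun y => (f y).im) x (Complex.imCLM.comp f') :=
    Complex.imCLM.hasMFDerivAt.comp x hf
  have hσ' := hσ.mdifferentiableAt (by simp)
  have hIσ := (contMDiffAt_I_smul hσ).mdifferentiableAt (by simp)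
  have h1 := D.isCovariantDerivativeOnUniv.leibniz hσ' hre.mdifferentiableAt
  have h2 := D.isCovariantDerivativeOnUniv.leibniz hIσ him.mdifferentiableAt
  have hsum : (fun y => f y • σ y) =
      (fun y => (f y).re) • σ + (fun y => (f y).im) • (fun y => Complex.I • σ y) :=
    funext fun y => smul_eq_re_add_im (f y) (σ y)
  have h3 := D.isCovariantDerivativeOnUniv.add (hre.mdifferentiableAt.smul_section hσ')
    (him.mdifferentiableAt.smul_section hIσ)
  have h4 : D (fun y => f y • σ y) x v = ((f x).re • D σ x v + (f' v).re • σ x) +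
      ((f x).im • (Complex.I • D σ x v) + (f' v).im • (Complex.I • σ x)) := by
    rw [hsum, h3, h1, h2, hD.complex_linear σ x hσ', mvfderiv, mvfderiv, hre.mfderiv, him.mfderiv]
    rfl
  rw [h4, smul_eq_re_add_im (f x), smul_eq_re_add_im (f' v)]
  abel

variable [RiemannianBundle (fun x : S => TangentSpace (𝓡 2) x)]
  {o : ∀ x : S, Orientation ℝ (TangentSpace (𝓡 2) x) (Fin 2)}

/-- Where `φ = fe` in a unitary frame `e` and `f ≠ 0`, the equation `∂̄_A φ = 0` determines the
connexion form: `A = Im (df / f) - *Re (df / f)`. -/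
lemma IsMetricConnexion.connForm_eq (hD : IsMetricConnexion D) {φ : ∀ x, L x} {x₀ y : S}
    (hy : y ∈ (trivializationAt ℂ L x₀).baseSet) {f : S → ℂ}
    (hφ : ContMDiffAt (𝓡 2) ((𝓡 2).prod 𝓘(ℝ, ℂ)) ∞ (fun z => TotalSpace.mk' ℂ z (φ z)) y)
    (hφf : ∀ᶠ z in 𝓝 y, φ z = f z • unitFrame L x₀ z) (hfy : f y ≠ 0)
    {f' : TangentSpace (𝓡 2) y →L[ℝ] ℂ} (hf : HasMFDerivAt (𝓡 2) 𝓘(ℝ, ℂ) f y f')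
    (hbar : dbar o D φ y = 0) (v : TangentSpace (𝓡 2) y) :
    connForm D x₀ y v = (f' v / f y).im + (f' (rot o y v) / f y).re := by
  have he := contMDiffAt_unitFrame hy
  have he0 : unitFrame L x₀ y ≠ 0 := norm_ne_zero_iff.1 (by rw [norm_unitFrame hy]; simp)
  set e := unitFrame L x₀
  have hfe : MDifferentiableAt (𝓡 2) ((𝓡 2).prod 𝓘(ℝ, ℂ))
      (fun z => TotalSpace.mk' ℂ z (f z • e z)) y :=
    (hφ.mdifferentiableAt (by simp)).congr_of_eventuallyEq (by
      filter_upwards [hφf] with z hz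
      rw [hz])
  have hloc : D φ y = D (fun z => f z • e z) y :=
    D.isCovariantDerivativeOnUniv.congr_of_eventuallyEq (hφ.mdifferentiableAt (by simp)) hfe
      univ_mem hφf
  have hDφ (w : TangentSpace (𝓡 2) y) :
      D φ y w = (f' w - f y * Complex.I * (connForm D x₀ y w : ℝ)) • e y := by
    rw [hloc, hD.leibniz he hf w, sub_smul, mul_smul, mul_smul, ← hD.I_smul_unitFrame hy w,
      smul_smul Complex.I, Complex.I_mul_I]
    module
  have hb : (2 : ℝ) • dbar o D φ y v = D φ y v + Complex.I • D φ y (rot o y v) := by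
    rw [dbar]
    change (2 : ℝ) • ((1 / 2 : ℝ) • (D φ y v + Complex.I • D φ y (rot o y v))) = _
    rw [smul_smul]
    norm_num
  rw [hbar, hDφ, hDφ, smul_smul, ← add_smul] at hb
  have hz := (smul_eq_zero.1 (hb.symm.trans (by simp))).resolve_right he0
  have hdiv : f' v / f y - Complex.I * (connForm D x₀ y v : ℝ) +
      (Complex.I * (f' (rot o y v) / f y) + (connForm D x₀ y (rot o y v) : ℝ)) = 0 := by
    have h2 : f' v / f y - Complex.I * (connForm D x₀ y v : ℝ) +
      (Complex.I * (f' (rot o y v) / f y) + (connForm D x₀ y (rot o y v) : ℝ)) =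
        (f' v - f y * Complex.I * (connForm D x₀ y v : ℝ) +
          Complex.I * (f' (rot o y v) - f y * Complex.I * (connForm D x₀ y (rot o y v) : ℝ))) /
          f y := by
      field_simp
      linear_combination (f y * (connForm D x₀ y (rot o y v) : ℝ)) * Complex.I_sq
    rw [h2, hz, zero_div]
  have him := congrArg Complex.im hdiv
  simp only [Complex.add_im, Complex.sub_im, Complex.I_mul_im, Complex.ofReal_re,
    Complex.ofReal_im, Complex.zero_im] at him
  linarith

end Connexions

/-! ### The magnetic field where the section does not vanish -/

section MagneticField

variable {S : Type*} [TopologicalSpace S] [ChartedSpace Plane S] [IsManifold (𝓡 2) ∞ S]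
  [RiemannianBundle (fun x : S => TangentSpace (𝓡 2) x)]
  [IsContMDiffRiemannianBundle (𝓡 2) ∞ Plane (fun x : S => TangentSpace (𝓡 2) x)]
  {o : ∀ x : S, Orientation ℝ (TangentSpace (𝓡 2) x) (Fin 2)}
  {L : S → Type*} [TopologicalSpace (Bundle.TotalSpace ℂ L)]
  [∀ x, NormedAddCommGroup (L x)] [∀ x, InnerProductSpace ℂ (L x)]
  [FiberBundle ℂ L] [VectorBundle ℂ ℂ L] [ContMDiffVectorBundle ∞ ℂ L (𝓡 2)]
  [IsContMDiffRiemannianBundle (𝓡 2) ∞ ℂ L]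
  {D : CovariantDerivative (𝓡 2) ℂ L}

omit [IsManifold (𝓡 2) ∞ S] [RiemannianBundle (fun x : S => TangentSpace (𝓡 2) x)]
  [IsContMDiffRiemannianBundle (𝓡 2) ∞ Plane (fun x : S => TangentSpace (𝓡 2) x)] in
/-- The coordinate of a smooth section in a unitary frame is smooth. -/
lemma contMDiffAt_inner_unitFrame {φ : ∀ x, L x} {x₀ y : S}
    (hy : y ∈ (trivializationAt ℂ L x₀).baseSet)
    (hφ : ContMDiffAt (𝓡 2) ((𝓡 2).prod 𝓘(ℝ, ℂ)) ∞ (fun z => TotalSpace.mk' ℂ z (φ z)) y) :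
    ContMDiffAt (𝓡 2) 𝓘(ℝ, ℂ) ∞ (fun z => (inner ℂ (unitFrame L x₀ z) (φ z) : ℂ)) y := by
  have he := contMDiffAt_unitFrame hy
  have h1 : ContMDiffAt (𝓡 2) 𝓘(ℝ, ℝ) ∞ (fun z => inner ℝ (unitFrame L x₀ z) (φ z)) y :=
    he.inner_bundle hφ
  have h2 : ContMDiffAt (𝓡 2) 𝓘(ℝ, ℝ) ∞
      (fun z => inner ℝ (Complex.I • unitFrame L x₀ z) (φ z)) y :=
    (contMDiffAt_I_smul he).inner_bundle hφ
  have h3 := (Complex.equivRealProdCLM.symm.contDiff (n := ∞)).contMDiff.contMDiffAt.comp y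
    (h1.prodMk_space h2)
  refine h3.congr_of_eventuallyEq (Eventually.of_forall fun z => ?_)
  simp only [Function.comp_apply]
  rw [real_inner_I_smul_left, real_inner_eq_re_inner ℂ]
  apply Complex.ext <;> simp

/-- Where a section with `∂̄_A φ = 0` does not vanish, `*B = Δ log |φ|`; in particular `*B ≥ 0` at
a local maximum of `|φ|`. -/
lemma IsMetricConnexion.starTwo_magneticField_nonneg (hD : IsMetricConnexion D)
    (ho : IsOrientation o) {φ : ∀ x, L x}
    (hφ : ContMDiff (𝓡 2) ((𝓡 2).prod 𝓘(ℝ, ℂ)) ∞ fun x => TotalSpace.mk' ℂ x (φ x))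
    (hbar : ∀ x, dbar o D φ x = 0) {x : S} (hx : φ x ≠ 0)
    (hmax : IsLocalMax (fun y => ‖φ y‖) x) : 0 ≤ starTwo o (magneticField D) x := by
  set f : S → ℂ := fun y => inner ℂ (unitFrame L x y) (φ y)
  have hxb : x ∈ (trivializationAt ℂ L x).baseSet := mem_baseSet_trivializationAt ℂ L x
  have hf : ContMDiffAt (𝓡 2) 𝓘(ℝ, ℂ) ∞ f x := contMDiffAt_inner_unitFrame hxb hφ.contMDiffAt
  have hφf {y : S} (hy : y ∈ (trivializationAt ℂ L x).baseSet) :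
      φ y = f y • unitFrame L x y :=
    eq_inner_smul_of_norm_eq_one (finrank_fiber L y) (norm_unitFrame hy) (φ y)
  have hnorm {y : S} (hy : y ∈ (trivializationAt ℂ L x).baseSet) : ‖φ y‖ = ‖f y‖ := by
    conv_lhs => rw [hφf hy]
    rw [norm_smul, norm_unitFrame hy, mul_one]
  have hfx : f x ≠ 0 := norm_ne_zero_iff.1 (by rw [← hnorm hxb]; exact norm_ne_zero_iff.2 hx)
  -- dividing by `f x` moves the values near `x` into the domain of the principal logarithm
  let l : S → ℂ := fun y => Complex.log (f y / f x)
  have hslit : ∀ᶠ y in 𝓝 x, f y / f x ∈ Complex.slitPlane := by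
    have hc : ContinuousAt (fun y => f y / f x) x := hf.continuousAt.div_const _
    refine hc.eventually (Complex.isOpen_slitPlane.mem_nhds ?_)
    simp only [div_self hfx]
    exact Complex.one_mem_slitPlane
  have hl : ContMDiffAt (𝓡 2) 𝓘(ℝ, ℂ) ∞ l x := by
    have h1 : ContDiffAt ℝ ∞ (fun z : ℂ => Complex.log (z / f x)) (f x) := by
      have h2 : ContDiffAt ℂ ∞ Complex.log (f x / f x) :=
        Complex.contDiffAt_log hslit.self_of_nhds
      exact ContDiffAt.comp (f x) (g := Complex.log) (f := fun z : ℂ => z / f x)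
        (h2.restrict_scalars ℝ) (contDiffAt_id.div_const (f x))
    exact h1.contMDiffAt.comp x hf
  let u : S → ℝ := fun y => (l y).re
  let θ : S → ℝ := fun y => (l y).im
  have hu : ContMDiffAt (𝓡 2) 𝓘(ℝ, ℝ) ∞ u x :=
    Complex.reCLM.contDiff.contMDiff.contMDiffAt.comp x hl
  have hθ : ContMDiffAt (𝓡 2) 𝓘(ℝ, ℝ) ∞ θ x :=
    Complex.imCLM.contDiff.contMDiff.contMDiffAt.comp x hl
  have hfd : ∀ᶠ y in 𝓝 x, MDifferentiableAt (𝓡 2) 𝓘(ℝ, ℂ) f y := by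
    have h1 : ∀ᶠ z in 𝓝 x, ContMDiffAt (𝓡 2) 𝓘(ℝ, ℂ) 1 f z :=
      (contMDiffAt_iff_contMDiffAt_nhds (by simp)).1 (hf.of_le (by simp))
    exact h1.mono fun y hy => hy.mdifferentiableAt one_ne_zero
  have hform : ∀ᶠ y in 𝓝 x,
      connForm D x y = (differential θ + (-1 : ℝ) • starOne o (differential u)) y := by
    filter_upwards [hfd, hslit, (eventually_mem_baseSet (L := L) x).eventually_nhds] with y hy hs hb
    have hfy : f y ≠ 0 := fun h => Complex.slitPlane_ne_zero hs (by rw [h, zero_div])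
    let f' : TangentSpace (𝓡 2) y →L[ℝ] ℂ := mfderiv (𝓡 2) 𝓘(ℝ, ℂ) f y
    have hly : HasMFDerivAt (𝓡 2) 𝓘(ℝ, ℂ) l y ((f y)⁻¹ • f') := by
      have h1 : HasFDerivAt (fun z : ℂ => Complex.log (z / f x))
          (((f y)⁻¹ : ℂ) • ContinuousLinearMap.id ℝ ℂ) (f y) := by
        have h2 := ((hasDerivAt_id (f y)).div_const (f x)).clog hs
        have h3 : (f x)⁻¹ / (f y / f x) = (f y)⁻¹ := by field_simp
        have h4 := h2.hasFDerivAt.restrictScalars ℝ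
        refine h4.congr_fderiv ?_
        ext z
        simp [h3, mul_comm]
      exact h1.hasMFDerivAt.comp y hy.hasMFDerivAt
    have hdu : HasMFDerivAt (𝓡 2) 𝓘(ℝ, ℝ) u y
        (Complex.reCLM.comp ((f y)⁻¹ • f')) :=
      Complex.reCLM.hasMFDerivAt.comp y hly
    have hdθ : HasMFDerivAt (𝓡 2) 𝓘(ℝ, ℝ) θ y
        (Complex.imCLM.comp ((f y)⁻¹ • f')) :=
      Complex.imCLM.hasMFDerivAt.comp y hly
    refine ContinuousLinearMap.ext fun v => ?_
    refine (hD.connForm_eq hb.self_of_nhds hφ.contMDiffAt (hb.mono fun z hz => hφf hz) hfy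
      (f' := f') hy.hasMFDerivAt (hbar y) v).trans ?_
    have h1 : differential θ y v = ((f y)⁻¹ * f' v).im :=
      congrArg (fun T : TangentSpace (𝓡 2) y →L[ℝ] ℝ => T v) hdθ.mfderiv
    have h2 (w : TangentSpace (𝓡 2) y) :
        differential u y w = ((f y)⁻¹ * f' w).re :=
      congrArg (fun T : TangentSpace (𝓡 2) y →L[ℝ] ℝ => T w) hdu.mfderiv
    have h3 : (differential θ + (-1 : ℝ) • starOne o (differential u)) y v =
        differential θ y v + (-1) * -(differential u y (rot o y v)) := rfl
    rw [h3, h1, h2, div_eq_inv_mul, div_eq_inv_mul, neg_one_mul, neg_neg]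
  have hcθ (i : Fin 2) : DifferentiableAt ℝ ((differential θ).coeff x i)
      (extChartAt (𝓡 2) x x) := by
    have h1 : (differential θ).coeff x i =ᶠ[𝓝 (extChartAt (𝓡 2) x x)] fun y =>
        fderiv ℝ (θ ∘ (extChartAt (𝓡 2) x).symm) y (EuclideanSpace.single i 1) := by
      filter_upwards [eventually_mdifferentiableAt_chart_symm hθ] with y hy
      exact coeff_differential hy.1 hy.2 i
    exact ((((contDiffAt_comp_chart_symm hθ).fderiv_right (m := ∞) (by simp)).clm_apply
      contDiffAt_const).differentiableAt (by simp)).congr_of_eventuallyEq h1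
  have hcu (i : Fin 2) : DifferentiableAt ℝ (((-1 : ℝ) • starOne o (differential u)).coeff x i)
      (extChartAt (𝓡 2) x x) :=
    ((contDiffAt_coeff_starOne_differential ho hu i).differentiableAt (by simp)).const_smul (-1 : ℝ)
  have hB : magneticField D x = (-1 : ℝ) • (starOne o (differential u)).d x := by
    rw [magneticField, OneForm.d_congr hform, OneForm.d_add hcθ hcu, d_differential hθ,
      OneForm.d_smul, zero_add]
  have hBu : starTwo o (magneticField D) x = laplacian o u x := by
    rw [laplacian, starTwo, starTwo, hB]
    simp [neg_div]
  rw [hBu]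
  refine laplacian_nonneg_of_isLocalMax ho hu ?_
  filter_upwards [hmax, eventually_mem_baseSet (L := L) x, hslit] with y hy hyb hs
  have hpos : 0 < ‖f y / f x‖ := norm_pos_iff.2 (Complex.slitPlane_ne_zero hs)
  change (Complex.log (f y / f x)).re ≤ (Complex.log (f x / f x)).re
  rw [Complex.log_re, Complex.log_re, div_self hfx]
  refine Real.log_le_log hpos ?_
  rw [norm_div, norm_one, div_le_one (norm_pos_iff.2 hfx), ← hnorm hyb, ← hnorm hxb]
  exact hy

end MagneticField

/-! ### Smoothness of the connexion form and the difference of two connexions -/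

section ConnexionDifference

variable {S : Type*} [TopologicalSpace S] [ChartedSpace Plane S] [IsManifold (𝓡 2) ∞ S]
  {L : S → Type*} [TopologicalSpace (Bundle.TotalSpace ℂ L)]
  [∀ x, NormedAddCommGroup (L x)] [∀ x, InnerProductSpace ℂ (L x)]
  [FiberBundle ℂ L] [VectorBundle ℂ ℂ L] [ContMDiffVectorBundle ∞ ℂ L (𝓡 2)]
  [IsContMDiffRiemannianBundle (𝓡 2) ∞ ℂ L]
  {D D' : CovariantDerivative (𝓡 2) ℂ L}

lemma IsMetricConnexion.contDiffAt_coeff_connForm [T2Space S] (hD : IsMetricConnexion D) (x : S)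
    (i : Fin 2) : ContDiffAt ℝ ∞ ((connForm D x).coeff x i) (extChartAt (𝓡 2) x x) := by
  set e := unitFrame L x
  have hU := (trivializationAt ℂ L x).open_baseSet
  have hxb : x ∈ (trivializationAt ℂ L x).baseSet := mem_baseSet_trivializationAt ℂ L x
  -- a cut-off makes the frame a global section, to which the smoothness of `D` applies
  obtain ⟨ψ, hψ, -⟩ := (SmoothBumpFunction.nhds_basis_support (I := 𝓡 2) (c := x)
    (hU.mem_nhds hxb)).mem_iff.1 (hU.mem_nhds hxb)
  have hσ : ContMDiff (𝓡 2) ((𝓡 2).prod 𝓘(ℝ, ℂ)) ∞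
      (fun z => TotalSpace.mk' ℂ z (((ψ : S → ℝ) • e) z)) :=
    ContMDiffOn.smul_section_of_tsupport (u := (trivializationAt ℂ L x).baseSet)
      ψ.contMDiff.contMDiffOn hU hψ fun z hz => (contMDiffAt_unitFrame hz).contMDiffWithinAt
  have hDσ := (hD.smooth.contMDiff.contMDiff (σ := (ψ : S → ℝ) • e)
    (hσ.contMDiffOn.of_le (by simp))).contMDiffAt (univ_mem (f := 𝓝 x))
  have hsymm : (extChartAt (𝓡 2) x).symm (extChartAt (𝓡 2) x x) = x := extChartAt_to_inv x
  have hy := mem_extChartAt_target (I := 𝓡 2) x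
  have hDσ' := hDσ.comp_of_eq (contMDiffAt_chart_symm x hy) hsymm
  have hw : ContMDiffAt 𝓘(ℝ, Plane) ((𝓡 2).prod 𝓘(ℝ, ℂ)) ∞
      (fun y => TotalSpace.mk' ℂ ((extChartAt (𝓡 2) x).symm y)
        (D ((ψ : S → ℝ) • e) ((extChartAt (𝓡 2) x).symm y) (coordVec x y i)))
      (extChartAt (𝓡 2) x x) :=
    ContMDiffAt.clm_bundle_apply hDσ' (contMDiffAt_coordVec x i hy)
  have hIe : ContMDiffAt 𝓘(ℝ, Plane) ((𝓡 2).prod 𝓘(ℝ, ℂ)) ∞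
      (fun y => TotalSpace.mk' ℂ ((extChartAt (𝓡 2) x).symm y)
        (Complex.I • e ((extChartAt (𝓡 2) x).symm y))) (extChartAt (𝓡 2) x x) :=
    (contMDiffAt_I_smul (contMDiffAt_unitFrame hxb)).comp_of_eq (contMDiffAt_chart_symm x hy) hsymm
  have hinner := (hIe.inner_bundle hw).contDiffAt.neg
  refine hinner.congr_of_eventuallyEq ?_
  have hψ1 : ∀ᶠ z in 𝓝 x, ∀ᶠ z' in 𝓝 z, ψ z' = 1 := ψ.eventuallyEq_one.eventually_nhds
  filter_upwards [(tendsto_chart_symm x).eventually hψ1,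
    (tendsto_chart_symm x).eventually (eventually_mem_baseSet (L := L) x)] with y h1 hyb
  have hloc : D ((ψ : S → ℝ) • e) ((extChartAt (𝓡 2) x).symm y) =
      D e ((extChartAt (𝓡 2) x).symm y) := by
    refine D.isCovariantDerivativeOnUniv.congr_of_eventuallyEq
      (hσ.mdifferentiable (by simp) _) (mdifferentiableAt_unitFrame hyb) univ_mem ?_
    filter_upwards [h1] with z hz
    rw [Pi.smul_apply', hz, one_smul]
  rw [OneForm.coeff, connForm_apply, real_inner_I_smul_right, real_inner_I_smul_left, hloc]

/-- The difference of the connexion forms of two connexions; see `connForm_sub_connForm` for the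
independence of the frame. -/
noncomputable def connDiff (D D' : CovariantDerivative (𝓡 2) ℂ L) : OneForm S := fun y =>
  connForm D y y - connForm D' y y

/-- The difference of two metric connexions on a hermitian line bundle is a global 1-form: in a
unitary frame it does not depend on the frame, since a connexion form changes by a term that
is the same for both. -/
lemma IsMetricConnexion.connForm_sub_connForm (hD : IsMetricConnexion D)
    (hD' : IsMetricConnexion D') {x₀ y : S} (hy : y ∈ (trivializationAt ℂ L x₀).baseSet) :
    connForm D x₀ y - connForm D' x₀ y = connDiff D D' y := by
  set e := unitFrame L x₀
  set e' := unitFrame L y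
  have hyy : y ∈ (trivializationAt ℂ L y).baseSet := mem_baseSet_trivializationAt ℂ L y
  have : ContMDiffVectorBundle 1 ℂ L (𝓡 2) := ContMDiffVectorBundle.of_le (n := ∞) (by simp)
  let T : L y →L[ℝ] TangentSpace (𝓡 2) y →L[ℝ] L y :=
    IsCovariantDerivativeOn.difference D.isCovariantDerivativeOnUniv
      D'.isCovariantDerivativeOnUniv y
  have hT {σ : ∀ x, L x} (hσ : MDifferentiableAt (𝓡 2) ((𝓡 2).prod 𝓘(ℝ, ℂ))
      (fun z => TotalSpace.mk' ℂ z (σ z)) y) : T (σ y) = D σ y - D' σ y :=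
    IsCovariantDerivativeOn.difference_apply _ _ (mem_univ y) hσ
  have hTe := hT (mdifferentiableAt_unitFrame (L := L) hy)
  have hTe' := hT (mdifferentiableAt_unitFrame (L := L) hyy)
  have hTI : T (Complex.I • e' y) = Complex.I • T (e' y) := by
    rw [hT (σ := fun z => Complex.I • e' z)
      ((contMDiffAt_I_smul (contMDiffAt_unitFrame hyy)).mdifferentiableAt (by simp)),
      hD.complex_linear e' y (mdifferentiableAt_unitFrame hyy),
      hD'.complex_linear e' y (mdifferentiableAt_unitFrame hyy), hTe', smul_sub]
  obtain ⟨c, hc⟩ : ∃ c : ℂ, e y = c • e' y :=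
    ⟨_, eq_inner_smul_of_norm_eq_one (finrank_fiber L y) (norm_unitFrame hyy) (e y)⟩
  have hc1 : ‖c‖ = 1 := by
    have h := congrArg norm hc
    rwa [norm_smul, norm_unitFrame hyy, mul_one, norm_unitFrame hy, eq_comm] at h
  refine ContinuousLinearMap.ext fun v => ?_
  have hTc : T (e y) v = c • T (e' y) v := by
    rw [hc, smul_eq_re_add_im, T.map_add, T.map_smul, T.map_smul, hTI, smul_eq_re_add_im]
    rfl
  have hl : (connForm D x₀ y - connForm D' x₀ y) v = inner ℝ (e y) (Complex.I • T (e y) v) := by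
    rw [hTe]
    change connForm D x₀ y v - connForm D' x₀ y v =
      inner ℝ (e y) (Complex.I • (D e y v - D' e y v))
    rw [smul_sub, inner_sub_right]
    rfl
  have hr : connDiff D D' y v = inner ℝ (e' y) (Complex.I • T (e' y) v) := by
    rw [hTe']
    change connForm D y y v - connForm D' y y v =
      inner ℝ (e' y) (Complex.I • (D e' y v - D' e' y v))
    rw [smul_sub, inner_sub_right]
    rfl
  rw [hl, hr, hTc, hc, smul_comm, real_inner_eq_re_inner ℂ, inner_smul_left, inner_smul_right,
    ← mul_assoc, ← Complex.normSq_eq_conj_mul_self, Complex.normSq_eq_norm_sq, hc1,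
    real_inner_eq_re_inner ℂ]
  simp

lemma IsMetricConnexion.eventually_connForm_eq (hD : IsMetricConnexion D)
    (hD' : IsMetricConnexion D') (x : S) :
    ∀ᶠ y in 𝓝 x, connForm D x y = (connForm D' x + connDiff D D') y := by
  filter_upwards [eventually_mem_baseSet (L := L) x] with y hy
  rw [Pi.add_apply, ← hD.connForm_sub_connForm hD' hy, add_sub_cancel]

lemma IsMetricConnexion.isC1_connDiff [T2Space S] (hD : IsMetricConnexion D)
    (hD' : IsMetricConnexion D') : (connDiff D D').IsC1 := fun x i => by
  have h : ContDiffAt ℝ 1 ((connDiff D D').coeff x i) (extChartAt (𝓡 2) x x) := by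
    refine (((hD.contDiffAt_coeff_connForm x i).sub
      (hD'.contDiffAt_coeff_connForm x i)).congr_of_eventuallyEq ?_).of_le (by simp)
    filter_upwards [(tendsto_chart_symm x).eventually (eventually_mem_baseSet (L := L) x)] with y hy
    rw [OneForm.coeff, ← hD.connForm_sub_connForm hD' hy]
    rfl
  exact h.eventually (by simp)

lemma IsMetricConnexion.magneticField_eq [T2Space S] (hD : IsMetricConnexion D)
    (hD' : IsMetricConnexion D') (x : S) :
    magneticField D x = magneticField D' x + (connDiff D D').d x := by
  rw [magneticField, OneForm.d_congr (hD.eventually_connForm_eq hD' x), OneForm.d_add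
    (fun i => (hD'.contDiffAt_coeff_connForm x i).differentiableAt (by simp))
    (fun i => (hD.isC1_connDiff hD').differentiableAt x i)]
  rfl

variable [RiemannianBundle (fun x : S => TangentSpace (𝓡 2) x)]
  [IsContMDiffRiemannianBundle (𝓡 2) ∞ Plane (fun x : S => TangentSpace (𝓡 2) x)]
  {o : ∀ x : S, Orientation ℝ (TangentSpace (𝓡 2) x) (Fin 2)}

/-- The total magnetic flux is the same for all metric connexions. -/
lemma IsMetricConnexion.integral_magneticField [T2Space S] [CompactSpace S]
    [MeasurableSpace S] [BorelSpace S] (hD : IsMetricConnexion D) (ho : IsOrientation o)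
    {n : ℤ} (hn : n ≠ 0) (hL : HasDegree L o n) :
    ∫ x, starTwo o (magneticField D) x ∂(riemannianVolume S) = 2 * Real.pi * n := by
  obtain ⟨D', hD', hint⟩ := hL
  have := isLocallyFiniteMeasure_riemannianVolume (S := S) o
  have hα := hD.isC1_connDiff hD'
  -- the integral of a non-integrable function is zero, so `n ≠ 0` gives integrability
  have hi' : Integrable (starTwo o (magneticField D')) (riemannianVolume S) := by
    refine not_imp_comm.1 integral_undef ?_
    rw [hint]
    have := Real.pi_ne_zero
    positivity
  have hi : Integrable (starTwo o (connDiff D D').d) (riemannianVolume S) :=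
    (hα.continuous_starTwo_d ho).integrable_of_hasCompactSupport
      (HasCompactSupport.of_compactSpace _)
  have hsum : starTwo o (magneticField D) =
      fun x => starTwo o (magneticField D') x + starTwo o (connDiff D D').d x :=
    funext fun x => starTwo_add_apply (hD.magneticField_eq hD' x)
  rw [hsum, integral_add hi' hi, hint, hα.integral_starTwo_d_eq_zero ho, add_zero]

end ConnexionDifference

/-! ### Solutions of the Bogomol'nyi equations -/

section Solutions

variable {S : Type*} [TopologicalSpace S] [ChartedSpace Plane S] [IsManifold (𝓡 2) ∞ S]
  [RiemannianBundle (fun x : S => TangentSpace (𝓡 2) x)]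
  {o : ∀ x : S, Orientation ℝ (TangentSpace (𝓡 2) x) (Fin 2)}

omit [IsManifold (𝓡 2) ∞ S] in
lemma laplacian_const_mul (c : ℝ) {f : S → ℝ} (hf : MDifferentiable (𝓡 2) 𝓘(ℝ, ℝ) f) (x : S) :
    laplacian o (fun y => c * f y) x = c * laplacian o f x := by
  have h1 : differential (fun y => c * f y) = c • differential f := by
    funext y
    exact ((hf y).hasMFDerivAt.const_smul c).mfderiv
  have h2 : starOne o (c • differential f) = c • starOne o (differential f) := by
    funext y
    refine ContinuousLinearMap.ext fun v => ?_
    exact (mul_neg c (differential f y (rot o y v))).symm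
  rw [laplacian, laplacian, h1, h2, starTwo, starTwo, OneForm.d_smul]
  simp [mul_div_assoc]

variable {L : S → Type*} [TopologicalSpace (Bundle.TotalSpace ℂ L)]
  [∀ x, NormedAddCommGroup (L x)] [∀ x, InnerProductSpace ℂ (L x)]
  [FiberBundle ℂ L] [VectorBundle ℂ ℂ L] [ContMDiffVectorBundle ∞ ℂ L (𝓡 2)]
  [IsContMDiffRiemannianBundle (𝓡 2) ∞ ℂ L]
  {κ : ℝ} {φ : ∀ x, L x} {D : CovariantDerivative (𝓡 2) ℂ L} {N : S → ℝ}

lemma IsBogomolnyiSolution.continuous_normSq (h : IsBogomolnyiSolution o κ φ D N) :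
    Continuous fun x => ‖φ x‖ ^ 2 := by
  have h1 : ContMDiff (𝓡 2) 𝓘(ℝ, ℝ) ∞ fun x => inner ℝ (φ x) (φ x) :=
    h.smooth_section.inner_bundle h.smooth_section
  simpa only [real_inner_self_eq_norm_sq] using h1.continuous

lemma IsBogomolnyiSolution.continuous_starTwo_magneticField (h : IsBogomolnyiSolution o κ φ D N) :
    Continuous (starTwo o (magneticField D)) := by
  rw [funext h.bog2]
  exact continuous_const.mul
    ((continuous_const.add (continuous_const.mul h.smooth_scalar.continuous)).sub
      h.continuous_normSq)

variable [IsContMDiffRiemannianBundle (𝓡 2) ∞ Plane (fun x : S => TangentSpace (𝓡 2) x)]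

/-- The maximum principle: `|φ| ≤ 1` and `κN ≤ 0`. -/
lemma IsBogomolnyiSolution.normSq_le_one_and_nonpos [CompactSpace S]
    (h : IsBogomolnyiSolution o κ φ D N) (ho : IsOrientation o) (x : S) :
    ‖φ x‖ ^ 2 ≤ 1 ∧ κ * N x ≤ 0 := by
  have hN := h.smooth_scalar.continuous
  obtain ⟨p, -, hp⟩ := isCompact_univ.exists_isMaxOn ⟨x, mem_univ x⟩
    h.continuous_normSq.continuousOn
  obtain ⟨q, -, hq⟩ := isCompact_univ.exists_isMaxOn ⟨x, mem_univ x⟩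
    (continuous_const.mul hN : Continuous fun y => κ * N y).continuousOn
  have hp' (y : S) : ‖φ y‖ ^ 2 ≤ ‖φ p‖ ^ 2 := hp (mem_univ y)
  have hq' (y : S) : κ * N y ≤ κ * N q := hq (mem_univ y)
  -- the third equation at a maximum of `κN`
  have hκN : κ * N q * (κ ^ 2 + ‖φ q‖ ^ 2) ≤ κ ^ 2 / 2 * (‖φ q‖ ^ 2 - 1) := by
    have h1 : 0 ≤ laplacian o (fun y => κ * N y) q :=
      laplacian_nonneg_of_isLocalMax ho
        ((contMDiff_const (c := κ)).mul h.smooth_scalar).contMDiffAt (Eventually.of_forall hq')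
    rw [laplacian_const_mul κ (h.smooth_scalar.mdifferentiable (by simp))] at h1
    have h2 := h.bog3 q
    rw [h.bog2 q] at h2
    have h3 : laplacian o N q = -(κ * (1 / 2 * (1 + 2 * κ * N q - ‖φ q‖ ^ 2)) +
        ‖φ q‖ ^ 2 * N q) := by linarith
    rw [h3] at h1
    nlinarith
  -- the second equation at a maximum of `|φ|`, where `*B ≥ 0`
  have hφ : ‖φ p‖ ^ 2 ≤ 0 ∨ ‖φ p‖ ^ 2 ≤ 1 + 2 * (κ * N q) := by
    by_cases hp0 : φ p = 0
    · exact Or.inl (by rw [hp0, norm_zero, zero_pow two_ne_zero])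
    · right
      have h1 := h.connexion.starTwo_magneticField_nonneg ho h.smooth_section h.bog1 hp0
        (Eventually.of_forall fun y =>
          (pow_le_pow_iff_left₀ (norm_nonneg _) (norm_nonneg _) two_ne_zero).1 (hp' y))
      rw [h.bog2 p] at h1
      have := hq' p
      linarith
  have hq0 : 0 ≤ ‖φ q‖ ^ 2 := by positivity
  have hqp := hp' q
  have hM : ‖φ p‖ ^ 2 ≤ 1 := by
    by_contra! hM
    have h1 : ‖φ p‖ ^ 2 ≤ 1 + 2 * (κ * N q) := hφ.resolve_left (by linarith)
    have hm : 0 < κ * N q := by linarith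
    have hκ : 0 < κ ^ 2 := by
      have : κ ≠ 0 := by
        rintro rfl
        simp at hm
      positivity
    have h2 : κ ^ 2 * (‖φ q‖ ^ 2 - 1) ≤ κ ^ 2 * (2 * (κ * N q)) := by
      gcongr
      linarith
    have h3 : κ * N q * ‖φ q‖ ^ 2 ≤ 0 := by linarith
    have h4 : ‖φ q‖ ^ 2 = 0 := by
      by_contra hne
      have : 0 < κ * N q * ‖φ q‖ ^ 2 := by positivity
      linarith
    rw [h4] at hκN
    have : 0 < κ * N q * κ ^ 2 := by positivity
    linarith
  refine ⟨(hp' x).trans hM, (hq' x).trans ?_⟩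
  by_contra! hm
  have hκ : 0 < κ ^ 2 := by
    have : κ ≠ 0 := by
      rintro rfl
      simp at hm
    positivity
  have h1 : 0 < κ * N q * (κ ^ 2 + ‖φ q‖ ^ 2) := by positivity
  have h2 : κ ^ 2 / 2 * (‖φ q‖ ^ 2 - 1) ≤ 0 :=
    mul_nonpos_of_nonneg_of_nonpos (by positivity) (by linarith)
  linarith

/-- By the equations, `1 - 2(1 + κ²) *B - 2κ ΔN = |φ|² - 2κN(1 - |φ|²)`; the right-hand side is
nonnegative by the maximum principle, and the integral of the left-hand side is
`Vol - 4πn(1 + κ²)`. -/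
lemma IsBogomolnyiSolution.volume_ge [T2Space S] [CompactSpace S] [MeasurableSpace S]
    [BorelSpace S] (h : IsBogomolnyiSolution o κ φ D N) (ho : IsOrientation o) {n : ℤ}
    (hn : n ≠ 0) (hL : HasDegree L o n) :
    4 * Real.pi * n * (1 + κ ^ 2) ≤ (riemannianVolume S).real univ := by
  have := isLocallyFiniteMeasure_riemannianVolume (S := S) o
  have hflux := h.connexion.integral_magneticField ho hn hL
  have hC1 := isC1_starOne_differential ho h.smooth_scalar
  have hdiv : ∫ x, laplacian o N x ∂(riemannianVolume S) = 0 := by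
    simp only [laplacian]
    rw [integral_neg, hC1.integral_starTwo_d_eq_zero ho, neg_zero]
  have hiB : Integrable (starTwo o (magneticField D)) (riemannianVolume S) :=
    h.continuous_starTwo_magneticField.integrable_of_hasCompactSupport
      (HasCompactSupport.of_compactSpace _)
  have hiN : Integrable (laplacian o N) (riemannianVolume S) :=
    (hC1.continuous_starTwo_d ho).neg.integrable_of_hasCompactSupport
      (HasCompactSupport.of_compactSpace _)
  have hpos : 0 ≤ ∫ x, (1 - 2 * (1 + κ ^ 2) * starTwo o (magneticField D) x -
      2 * κ * laplacian o N x) ∂(riemannianVolume S) := by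
    refine integral_nonneg fun x => ?_
    obtain ⟨h1, h2⟩ := h.normSq_le_one_and_nonpos ho x
    have h3 : (1 - 2 * (1 + κ ^ 2) * starTwo o (magneticField D) x - 2 * κ * laplacian o N x) =
        ‖φ x‖ ^ 2 - 2 * ((κ * N x) * (1 - ‖φ x‖ ^ 2)) := by
      linear_combination (-2) * h.bog2 x - 2 * κ * h.bog3 x
    have h4 : (κ * N x) * (1 - ‖φ x‖ ^ 2) ≤ 0 :=
      mul_nonpos_of_nonpos_of_nonneg h2 (by linarith)
    have h5 : 0 ≤ ‖φ x‖ ^ 2 := by positivity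
    change 0 ≤ _
    rw [h3]
    linarith
  have hi1 : Integrable (fun x => 1 - 2 * (1 + κ ^ 2) * starTwo o (magneticField D) x)
      (riemannianVolume S) := (integrable_const 1).sub (hiB.const_mul _)
  rw [integral_sub hi1 (hiN.const_mul _),
    integral_sub (integrable_const 1) (hiB.const_mul _), integral_const_mul, integral_const_mul,
    hflux, hdiv, integral_const, smul_eq_mul] at hpos
  linarith

end Solutions

end MCSH

theorem theorem2
    -- a compact oriented Riemannian surface
    {S : Type*} [TopologicalSpace S] [T2Space S] [CompactSpace S]
    [ChartedSpace (EuclideanSpace ℝ (Fin 2)) S] [IsManifold (𝓡 2) ∞ S]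
    [MeasurableSpace S] [BorelSpace S]
    [RiemannianBundle (fun x : S => TangentSpace (𝓡 2) x)]
    [IsContMDiffRiemannianBundle (𝓡 2) ∞ (EuclideanSpace ℝ (Fin 2))
      (fun x : S => TangentSpace (𝓡 2) x)]
    (o : ∀ x : S, Orientation ℝ (TangentSpace (𝓡 2) x) (Fin 2)) (ho : MCSH.IsOrientation o)
    -- a smooth hermitian line bundle of degree `n ≥ 1`
    {L : S → Type*} [TopologicalSpace (Bundle.TotalSpace ℂ L)]
    [∀ x, NormedAddCommGroup (L x)] [∀ x, InnerProductSpace ℂ (L x)]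
    [FiberBundle ℂ L] [VectorBundle ℂ ℂ L] [ContMDiffVectorBundle ∞ ℂ L (𝓡 2)]
    [IsContMDiffRiemannianBundle (𝓡 2) ∞ ℂ L]
    (n : ℕ) (hn : 1 ≤ n) (hL : MCSH.HasDegree L o n)
    -- the Chern-Simons coupling
    (κ : ℝ) :
    ((∃ (φ : ∀ x, L x) (D : CovariantDerivative (𝓡 2) ℂ L) (N : S → ℝ),
        MCSH.IsBogomolnyiSolution o κ φ D N) →
      κ ^ 2 ≤ (MCSH.riemannianVolume S).real Set.univ / (4 * Real.pi * n) - 1) ∧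
    ((MCSH.riemannianVolume S).real Set.univ < 4 * Real.pi * n * (1 + κ ^ 2) →
      ¬ ∃ (φ : ∀ x, L x) (D : CovariantDerivative (𝓡 2) ℂ L) (N : S → ℝ),
        MCSH.IsBogomolnyiSolution o κ φ D N) := by
  have hn' : (0 : ℝ) < n := by exact_mod_cast hn
  have hpi := Real.pi_pos
  have key : (∃ (φ : ∀ x, L x) (D : CovariantDerivative (𝓡 2) ℂ L) (N : S → ℝ),
      MCSH.IsBogomolnyiSolution o κ φ D N) →
        4 * Real.pi * n * (1 + κ ^ 2) ≤ (MCSH.riemannianVolume S).real Set.univ := by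
    rintro ⟨φ, D, N, h⟩
    exact_mod_cast h.volume_ge ho (by omega) hL
  refine ⟨fun h => ?_, fun hlt h => absurd (key h) (not_le.2 hlt)⟩
  rw [le_sub_iff_add_le, le_div_iff₀ (by positivity)]
  linarith [key h]
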